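/- **Conventions.** For partially defined expressions write $x\simeq y$ if both are undefined, or both are defined and equal; write $x\preceq y$ if $x$ is undefined, or both are defined and equal. Let $(\mathcal C,\otimes,I,\sigma)$ be a symmetric monoidal category (formulas are written as if $\mathcal C$ were strict; in general the canonical associativity and unit isomorphisms are inserted). A *partial trace* (Haghverdi–Scott) on $\mathcal C$ is a family of partial functions $\mathrm{Tr}^U_{A,B}:\mathcal C(A\otimes U,B\otimes U)\rightharpoonup\mathcal C(A,B)$ such that - (naturality) $h\circ \mathrm{Tr}^U(f)\circ g\preceq \mathrm{Tr}^U((h\otimes 1_U)\circ f\circ(g\otimes 1_U))$; - (dinaturality) $\mathrm{Tr}^U((1_B\otimes g)\circ f)\simeq \mathrm{Tr}^{U'}(f\circ(1_A\otimes g))$ for $f:A\otimes U\to B\otimes U'$, $g:U'\to U$; - (strength) $g\otimes \mathrm{Tr}^U(f)\preceq \mathrm{Tr}^U(g\otimes f)$; - (vanishing I) $\mathrm{Tr}^I(f)\simeq f$; - (vanishing II) if $\mathrm{Tr}^V(f)$ is defined, then $\mathrm{Tr}^U(\mathrm{Tr}^V(f))\simeq \mathrm{Tr}^{U\otimes V}(f)$;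 - (yanking) $\mathrm{Tr}^A(\sigma_{A,A})\simeq 1_A$. A *partially traced category* is a symmetric monoidal category with a partial trace; it is *totally traced* if every $\mathrm{Tr}^U_{A,B}$ is a total function. In a compact closed category, with duals $U^*$, units $\eta_U:I\to U^*\otimes U$ and counits $\varepsilon_U:U\otimes U^*\to I$, the *canonical trace* is $\mathrm{Tr}^U(f)=(1_B\otimes\varepsilon_U)\circ(f\otimes 1_{U^*})\circ(1_A\otimes\sigma_{U^*,U})\circ(1_A\otimes\eta_U)$. **The construction.** Let $\mathcal C$ be a partially traced category. The graph $\mathrm{Int}^p(\mathcal C)$ has as objects the pairs $A=(A^+,A^-)$ of objects of $\mathcal C$, and as arrows $A\to B$ the morphisms $A^+\otimes B^-\to B^+\otimes A^-$ of $\mathcal C$. For a path $\vec p=p_1,\dots,p_n$ with vertices $A_0,\dots,A_n$ put $V_n=A_0^-\otimes\dots\otimes A_{n-1}^-$ and define $[\![\vec p]\!]:A_0^+\otimes V_n\otimes A_n^-\to A_n^+\otimes A_0^-\otimes V_n$ recursively: $[\![\ ]\!]=1$, and $$[\![\vec p,g]\!]=(1\otimes\sigma_{A_n^-,\,A_0^-\otimes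 V_n})\circ(g\otimes 1)\circ(1\otimes\sigma_{A_0^-\otimes V_n,\,A_{n+1}^-})\circ([\![\vec p]\!]\otimes 1_{A_{n+1}^-})$$ for $g:A_n\to A_{n+1}$. The partial composite of $\vec p$ is $[\vec p]\simeq\mathrm{Tr}^{V_n}([\![\vec p]\!]\circ(1_{A_0^+}\otimes\sigma_{A_n^-,V_n}))$. The identity arrow $1_A$ of $A$ is the identity of $A^+\otimes A^-$. The tensor on $\mathrm{Int}^p(\mathcal C)$ is $A\otimes B=(A^+\otimes B^+,B^-\otimes A^-)$ on objects with unit $(I,I)$; for $f:A\to A'$ and $g:B\to B'$ the arrow $f\otimes g$ is the morphism $(1_{A'^+}\otimes\sigma_{A^-,\,B'^+\otimes B^-})\circ(f\otimes g)\circ(1_{A^+}\otimes\sigma_{B^+\otimes B'^-,\,A'^-})$ of $\mathcal C$. The symmetry is $\sigma_{A^+,B^+}\otimes\sigma_{A^-,B^-}$; the dual is $A^*=(A^-,A^+)$, with $\eta_A$ and $\varepsilon_A$ given by the identities of $A^-\otimes A^+$ and of $A^+\otimes A^-$. Let $\mathrm{Path}(\mathrm{Int}^p(\mathcal C))$ be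 the category of paths of this graph under concatenation, and let $\sim$ be the smallest family of equivalence relations on its hom-sets that is compatible with concatenation, satisfies $\vec p\sim[\vec p]$ (as a path of length one) whenever $[\vec p]$ is defined, and satisfies $\vec p\otimes 1_X\sim\vec q\otimes 1_X$ and $1_X\otimes\vec p\sim1_X\otimes\vec q$ whenever $\vec p\sim\vec q$ (tensoring a path arrow by arrow). Let $N(A)=(A,I)$ and $N(f)=f$ for objects $A$ and morphisms $f$ of $\mathcal C$, and let $Q$ be the map from $\mathrm{Int}^p(\mathcal C)$ to $\mathrm{Path}(\mathrm{Int}^p(\mathcal C))/{\sim}$ that is the identity on objects and sends an arrow to the class of the corresponding path of length one. **Theorem.** Every partially traced category $\mathcal C$ can be faithfully embedded in a totally traced category, by an embedding that preserves and reflects the trace. More precisely: 1. the category $\mathcal D=\mathrm{Path}(\mathrm{Int}^p(\mathcal C))/{\sim}$ is a compact closed category, whose tensor, unit, symmetry, structural isomorphisms, duals, units and counits are those induced from $\mathrm{Int}^p(\mathcal C)$ along $Q$; 2. the canonical trace of $\mathcal D$ is a total trace; 3. the composite $F=Q\circ N:\mathcal C\to\mathrm{Int}^p(\mathcal C)\to\mathcal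 D$ is a faithful strong symmetric monoidal functor, whose comparison isomorphisms $m_{A,B}:FA\otimes FB\to F(A\otimes B)$ and $m_I:I\to FI$ are the canonical ones (identities if $\mathcal C$ is strict); 4. for all $f:A\otimes U\to B\otimes U$ and $g:A\to B$ in $\mathcal C$: $\mathrm{Tr}^U(f)$ is defined and equal to $g$ if and only if $\mathrm{Tr}^{FU}(m_{B,U}^{-1}\circ F(f)\circ m_{A,U})=F(g)$ in $\mathcal D$. -/

import Mathlib

open CategoryTheory MonoidalCategory

universe v u

noncomputable section

/-! ### Partial and total traces -/

/-- A partial trace (Haghverdi–Scott) on a symmetric monoidal category. Partial values are elements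
of `Part`: equality in `Part` is Kleene equality, and `x ≤ y` in `Part` (every value of `x` is a
value of `y`) is directed Kleene equality. -/
class PartialTrace (C : Type u) [Category.{v} C] [MonoidalCategory C] [SymmetricCategory C] where
  /-- The partial operation `Tr^U_{A,B}`. -/
  tr {A B : C} (U : C) (f : A ⊗ U ⟶ B ⊗ U) : Part (A ⟶ B)
  naturality {A B A' B' U : C} (f : A ⊗ U ⟶ B ⊗ U) (g : A' ⟶ A) (h : B ⟶ B') :
    (tr U f).map (fun t => g ≫ t ≫ h) ≤ tr U (g ▷ U ≫ f ≫ h ▷ U)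
  dinaturality {A B U U' : C} (f : A ⊗ U ⟶ B ⊗ U') (g : U' ⟶ U) :
    tr U (f ≫ B ◁ g) = tr U' (A ◁ g ≫ f)
  strength {A B U X Y : C} (f : A ⊗ U ⟶ B ⊗ U) (g : X ⟶ Y) :
    (tr U f).map (fun t => g ⊗ₘ t) ≤ tr U ((α_ X A U).hom ≫ (g ⊗ₘ f) ≫ (α_ Y B U).inv)
  vanishing_unit {A B : C} (f : A ⊗ 𝟙_ C ⟶ B ⊗ 𝟙_ C) :
    tr (𝟙_ C) f = Part.some ((ρ_ A).inv ≫ f ≫ (ρ_ B).hom)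
  vanishing_tensor {A B U V : C} (f : (A ⊗ U) ⊗ V ⟶ (B ⊗ U) ⊗ V) :
    (tr V f).Dom →
      (tr V f).bind (tr U) = tr (U ⊗ V) ((α_ A U V).inv ≫ f ≫ (α_ B U V).hom)
  yanking (A : C) : tr A (β_ A A).hom = Part.some (𝟙 A)

/-- A (total) trace on a symmetric monoidal category. -/
structure TotalTrace (D : Type u) [Category.{v} D] [MonoidalCategory D] [SymmetricCategory D] where
  /-- The operation `Tr^U_{A,B}`. -/
  tr {A B : D} (U : D) (f : A ⊗ U ⟶ B ⊗ U) : A ⟶ B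
  naturality {A B A' B' U : D} (f : A ⊗ U ⟶ B ⊗ U) (g : A' ⟶ A) (h : B ⟶ B') :
    g ≫ tr U f ≫ h = tr U (g ▷ U ≫ f ≫ h ▷ U)
  dinaturality {A B U U' : D} (f : A ⊗ U ⟶ B ⊗ U') (g : U' ⟶ U) :
    tr U (f ≫ B ◁ g) = tr U' (A ◁ g ≫ f)
  strength {A B U X Y : D} (f : A ⊗ U ⟶ B ⊗ U) (g : X ⟶ Y) :
    g ⊗ₘ tr U f = tr U ((α_ X A U).hom ≫ (g ⊗ₘ f) ≫ (α_ Y B U).inv)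
  vanishing_unit {A B : D} (f : A ⊗ 𝟙_ D ⟶ B ⊗ 𝟙_ D) :
    tr (𝟙_ D) f = (ρ_ A).inv ≫ f ≫ (ρ_ B).hom
  vanishing_tensor {A B U V : D} (f : (A ⊗ U) ⊗ V ⟶ (B ⊗ U) ⊗ V) :
    tr U (tr V f) = tr (U ⊗ V) ((α_ A U V).inv ≫ f ≫ (α_ B U V).hom)
  yanking (A : D) : tr A (β_ A A).hom = 𝟙 A

/-- The formula of the canonical trace of a compact closed category. A compact closed category is a
symmetric monoidal category in which every object `U` has a chosen dual `U* = ᘁU` with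
`η : 𝟙 ⟶ U* ⊗ U` and `ε : U ⊗ U* ⟶ 𝟙`, i.e. a symmetric category with `LeftRigidCategory`. -/
def canonicalTrace {D : Type u} [Category.{v} D] [MonoidalCategory D] [SymmetricCategory D]
    [LeftRigidCategory D] {A B : D} (U : D) (f : A ⊗ U ⟶ B ⊗ U) : A ⟶ B :=
  (ρ_ A).inv ≫ A ◁ η_ (HasLeftDual.leftDual U) U ≫
    A ◁ (β_ (HasLeftDual.leftDual U) U).hom ≫
    (α_ A U (HasLeftDual.leftDual U)).inv ≫
    f ▷ HasLeftDual.leftDual U ≫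
    (α_ B U (HasLeftDual.leftDual U)).hom ≫
    B ◁ ε_ (HasLeftDual.leftDual U) U ≫ (ρ_ B).hom

/-! ### The graph `Int^p(C)`

`C` is not assumed to be strict; the canonical associativity and unit isomorphisms are inserted
where the strict definition has identities (`⊗≫` is composition with the unique structural
isomorphism inserted between the two factors). -/

/-- Objects of `Int^p(C)`: pairs `(A⁺, A⁻)` of objects of `C`. -/
structure IntP (C : Type u) where
  pos : C
  neg : C

namespace IntP

variable {C : Type u} [Category.{v} C] [MonoidalCategory C]

/-- An arrow `A ⟶ B` of `Int^p(C)` is a morphism `A⁺ ⊗ B⁻ ⟶ B⁺ ⊗ A⁻` of `C`. -/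
structure Hom (A B : IntP C) where
  hom : A.pos ⊗ B.neg ⟶ B.pos ⊗ A.neg

instance : Quiver (IntP C) where
  Hom A B := Hom A B

/-- The identity arrow `1_A`, which is also the composite of the empty path at `A`. -/
def idHom (A : IntP C) : A ⟶ A := Hom.mk (𝟙 (A.pos ⊗ A.neg))

/-- For a path with vertices `A₀, …, Aₙ`, the object `A₀⁻ ⊗ ⋯ ⊗ Aₙ₋₁⁻`. -/
def feedback {A : IntP C} : ∀ {B : IntP C}, Quiver.Path A B → C
  | _, .nil => 𝟙_ C
  | _, @Quiver.Path.cons _ _ _ B _ p _ => feedback p ⊗ B.neg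

variable [SymmetricCategory C]

/-- Precomposition of a path with vertices `A₀, …, Aₙ`: a morphism
`A₀⁺ ⊗ (A₀⁻ ⊗ ⋯ ⊗ Aₙ₋₁⁻) ⊗ Aₙ⁻ ⟶ Aₙ⁺ ⊗ A₀⁻ ⊗ (A₀⁻ ⊗ ⋯ ⊗ Aₙ₋₁⁻)`. A further arrow
`g : B ⟶ D` is applied to the wires `B⁺` and `D⁻`; its output `B⁻` becomes the last wire. -/
def precomp {A : IntP C} : ∀ {B : IntP C} (p : Quiver.Path A B),
    A.pos ⊗ (feedback p ⊗ B.neg) ⟶ B.pos ⊗ (A.neg ⊗ feedback p)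
  | _, .nil => A.pos ◁ ((λ_ A.neg).hom ≫ (ρ_ A.neg).inv)
  | D, @Quiver.Path.cons _ _ _ B _ p g =>
      𝟙 (A.pos ⊗ ((feedback p ⊗ B.neg) ⊗ D.neg)) ⊗≫
        precomp p ▷ D.neg ⊗≫
        B.pos ◁ (β_ (A.neg ⊗ feedback p) D.neg).hom ⊗≫
        g.hom ▷ (A.neg ⊗ feedback p) ⊗≫
        D.pos ◁ (β_ B.neg (A.neg ⊗ feedback p)).hom ⊗≫
        𝟙 (D.pos ⊗ (A.neg ⊗ (feedback p ⊗ B.neg)))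

/-- The partial composition `[p]` of a path in `Int^p(C)`. -/
def comp [PartialTrace C] {A B : IntP C} (p : Quiver.Path A B) : Part (A ⟶ B) :=
  (PartialTrace.tr (feedback p)
    (𝟙 ((A.pos ⊗ B.neg) ⊗ feedback p) ⊗≫
      A.pos ◁ (β_ B.neg (feedback p)).hom ⊗≫
      precomp p ⊗≫
      𝟙 ((B.pos ⊗ A.neg) ⊗ feedback p))).map Hom.mk

/-! ### Tensor, symmetry and duals on `Int^p(C)` -/

/-- `(A⁺, A⁻) ⊗ (B⁺, B⁻) = (A⁺ ⊗ B⁺, B⁻ ⊗ A⁻)`. -/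
def tensorObj (A B : IntP C) : IntP C := ⟨A.pos ⊗ B.pos, B.neg ⊗ A.neg⟩

/-- The tensor unit `(I, I)`. -/
def unit (C : Type u) [Category.{v} C] [MonoidalCategory C] : IntP C := ⟨𝟙_ C, 𝟙_ C⟩

/-- The tensor of arrows: `f` and `g` are placed in parallel, after and before permuting wires. -/
def tensorHom {A A' B B' : IntP C} (f : A ⟶ A') (g : B ⟶ B') :
    tensorObj A B ⟶ tensorObj A' B' :=
  Hom.mk (𝟙 ((A.pos ⊗ B.pos) ⊗ (B'.neg ⊗ A'.neg)) ⊗≫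
    A.pos ◁ (β_ (B.pos ⊗ B'.neg) A'.neg).hom ⊗≫
    (f.hom ⊗ₘ g.hom) ⊗≫
    A'.pos ◁ (β_ A.neg (B'.pos ⊗ B.neg)).hom ⊗≫
    𝟙 ((A'.pos ⊗ B'.pos) ⊗ (B.neg ⊗ A.neg)))

/-- The symmetry `σ_{A⁺,B⁺} ⊗ σ_{A⁻,B⁻}`. -/
def braidHom (A B : IntP C) : tensorObj A B ⟶ tensorObj B A :=
  Hom.mk ((β_ A.pos B.pos).hom ⊗ₘ (β_ A.neg B.neg).hom)

/-- The associativity arrow (an identity when `C` is strict). -/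
def assocHom (A B D : IntP C) :
    tensorObj (tensorObj A B) D ⟶ tensorObj A (tensorObj B D) :=
  Hom.mk ((α_ A.pos B.pos D.pos).hom ⊗ₘ (α_ D.neg B.neg A.neg).hom)

/-- The left unit arrow (an identity when `C` is strict). -/
def leftUnitHom (A : IntP C) : tensorObj (unit C) A ⟶ A :=
  Hom.mk ((λ_ A.pos).hom ⊗ₘ (ρ_ A.neg).inv)

/-- The right unit arrow (an identity when `C` is strict). -/
def rightUnitHom (A : IntP C) : tensorObj A (unit C) ⟶ A :=
  Hom.mk ((ρ_ A.pos).hom ⊗ₘ (λ_ A.neg).inv)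

/-- `(A⁺, A⁻)* = (A⁻, A⁺)`. -/
def dual (A : IntP C) : IntP C := ⟨A.neg, A.pos⟩

/-- The unit `η_A : I ⟶ A* ⊗ A`, given by the identity of `A⁻ ⊗ A⁺`. -/
def etaHom (A : IntP C) : unit C ⟶ tensorObj A.dual A :=
  Hom.mk ((λ_ (A.neg ⊗ A.pos)).hom ≫ (ρ_ (A.neg ⊗ A.pos)).inv)

/-- The counit `ε_A : A ⊗ A* ⟶ I`, given by the identity of `A⁺ ⊗ A⁻`. -/
def epsHom (A : IntP C) : tensorObj A A.dual ⟶ unit C :=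
  Hom.mk ((ρ_ (A.pos ⊗ A.neg)).hom ≫ (λ_ (A.pos ⊗ A.neg)).inv)

/-- The graph homomorphism `1_X ⊗ -`. -/
def tensorLeft (X : IntP C) : IntP C ⥤q IntP C where
  obj A := tensorObj X A
  map f := tensorHom (idHom X) f

/-- The graph homomorphism `- ⊗ 1_X`. -/
def tensorRight (X : IntP C) : IntP C ⥤q IntP C where
  obj A := tensorObj A X
  map f := tensorHom f (idHom X)

/-- The graph homomorphism `N : C → Int^p(C)`, `N A = (A, I)`, `N f = f`. -/
def embed (C : Type u) [Category.{v} C] [MonoidalCategory C] : C ⥤q IntP C where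
  obj A := ⟨A, 𝟙_ C⟩
  map f := Hom.mk (f ▷ 𝟙_ C)

/-- The comparison arrow `N A ⊗ N B ⟶ N (A ⊗ B)` (an identity when `C` is strict). -/
def embedMu (A B : C) :
    tensorObj ((embed C).obj A) ((embed C).obj B) ⟶ (embed C).obj (A ⊗ B) :=
  Hom.mk ((A ⊗ B) ◁ (λ_ (𝟙_ C)).inv)

/-! ### The completion `Path(Int^p(C))/∼` -/

variable [PartialTrace C]

/-- A congruence relation on the path category of `Int^p(C)`. -/
structure IsCongruence (S : ∀ A B : IntP C, Quiver.Path A B → Quiver.Path A B → Prop) : Prop where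
  equivalence (A B : IntP C) : Equivalence (S A B)
  comp {A B D : IntP C} {p p' : Quiver.Path A B} {q q' : Quiver.Path B D} :
    S A B p p' → S B D q q' → S A D (p.comp q) (p'.comp q')
  eval {A B : IntP C} (p : Quiver.Path A B) (f : A ⟶ B) :
    f ∈ IntP.comp p → S A B p f.toPath
  tensorRight {A B : IntP C} {p q : Quiver.Path A B} (X : IntP C) :
    S A B p q → S _ _ ((tensorRight X).mapPath p) ((tensorRight X).mapPath q)
  tensorLeft {A B : IntP C} {p q : Quiver.Path A B} (X : IntP C) :
    S A B p q → S _ _ ((tensorLeft X).mapPath p) ((tensorLeft X).mapPath q)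

/-- The smallest congruence `∼`: the intersection of all congruences. -/
def sim (C : Type u) [Category.{v} C] [MonoidalCategory C] [SymmetricCategory C]
    [PartialTrace C] : HomRel (Paths (IntP C)) :=
  fun A B p q =>
    ∀ S : ∀ A B : IntP C, Quiver.Path A B → Quiver.Path A B → Prop, IsCongruence S → S A B p q

/-- The category `Path(Int^p(C))/∼`. -/
abbrev Completion (C : Type u) [Category.{v} C] [MonoidalCategory C] [SymmetricCategory C]
    [PartialTrace C] : Type u :=
  CategoryTheory.Quotient (sim C)

/-- The graph homomorphism `Int^p(C) → Path(Int^p(C))/∼` sending an arrow to the class of the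
corresponding path of length one. -/
def toCompletion (C : Type u) [Category.{v} C] [MonoidalCategory C] [SymmetricCategory C]
    [PartialTrace C] : IntP C ⥤q Completion C :=
  Paths.of (IntP C) ⋙q (CategoryTheory.Quotient.functor (sim C)).toPrefunctor

/-- The compact closed structure on `Path(Int^p(C))/∼` is the one induced from `Int^p(C)`: the
canonical map `Int^p(C) → Path(Int^p(C))/∼` strictly preserves the tensor of objects and arrows,
the unit, the symmetry, the duals with their units and counits, and the structural isomorphisms. -/
structure IsInducedStructure (C : Type u) [Category.{v} C] [MonoidalCategory C]
    [SymmetricCategory C] [PartialTrace C] [MonoidalCategory (Completion C)]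
    [SymmetricCategory (Completion C)] [LeftRigidCategory (Completion C)] : Prop where
  tensorObj_eq (A B : IntP C) :
    (toCompletion C).obj A ⊗ (toCompletion C).obj B = (toCompletion C).obj (tensorObj A B)
  unit_eq : 𝟙_ (Completion C) = (toCompletion C).obj (unit C)
  tensorHom_eq {A A' B B' : IntP C} (f : A ⟶ A') (g : B ⟶ B') :
    (toCompletion C).map f ⊗ₘ (toCompletion C).map g =
      eqToHom (tensorObj_eq A B) ≫ (toCompletion C).map (tensorHom f g) ≫
        eqToHom (tensorObj_eq A' B').symm
  associator_eq (A B D : IntP C) :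
    (α_ ((toCompletion C).obj A) ((toCompletion C).obj B) ((toCompletion C).obj D)).hom =
      eqToHom (by rw [tensorObj_eq, tensorObj_eq]) ≫ (toCompletion C).map (assocHom A B D) ≫
        eqToHom (by rw [tensorObj_eq, tensorObj_eq])
  leftUnitor_eq (A : IntP C) :
    (λ_ ((toCompletion C).obj A)).hom =
      eqToHom (by rw [unit_eq, tensorObj_eq]) ≫ (toCompletion C).map (leftUnitHom A)
  rightUnitor_eq (A : IntP C) :
    (ρ_ ((toCompletion C).obj A)).hom =
      eqToHom (by rw [unit_eq, tensorObj_eq]) ≫ (toCompletion C).map (rightUnitHom A)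
  braiding_eq (A B : IntP C) :
    (β_ ((toCompletion C).obj A) ((toCompletion C).obj B)).hom =
      eqToHom (tensorObj_eq A B) ≫ (toCompletion C).map (braidHom A B) ≫
        eqToHom (tensorObj_eq B A).symm
  dual_eq (A : IntP C) :
    HasLeftDual.leftDual ((toCompletion C).obj A) = (toCompletion C).obj A.dual
  eta_eq (A : IntP C) :
    η_ (HasLeftDual.leftDual ((toCompletion C).obj A)) ((toCompletion C).obj A) =
      eqToHom unit_eq ≫ (toCompletion C).map (etaHom A) ≫
        eqToHom (by rw [dual_eq, tensorObj_eq])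
  eps_eq (A : IntP C) :
    ε_ (HasLeftDual.leftDual ((toCompletion C).obj A)) ((toCompletion C).obj A) =
      eqToHom (by rw [dual_eq, tensorObj_eq]) ≫ (toCompletion C).map (epsHom A) ≫
        eqToHom unit_eq.symm

/-- A strong symmetric monoidal functor `C ⥤ Path(Int^p(C))/∼` is the composite
`C → Int^p(C) → Path(Int^p(C))/∼`: on objects and morphisms, and with the comparison isomorphisms
coming from `Int^p(C)`. -/
structure IsComposite {C : Type u} [Category.{v} C] [MonoidalCategory C]
    [SymmetricCategory C] [PartialTrace C] [MonoidalCategory (Completion C)]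
    [SymmetricCategory (Completion C)] [LeftRigidCategory (Completion C)]
    (hD : IsInducedStructure C) (F : C ⥤ Completion C) [F.Braided] : Prop where
  obj_eq (A : C) : F.obj A = (toCompletion C).obj ((embed C).obj A)
  map_eq {A B : C} (f : A ⟶ B) :
    F.map f = eqToHom (obj_eq A) ≫ (toCompletion C).map ((embed C).map f) ≫
      eqToHom (obj_eq B).symm
  unit_eq : Functor.LaxMonoidal.ε F = eqToHom (hD.unit_eq.trans (obj_eq (𝟙_ C)).symm)
  mu_eq (A B : C) : Functor.LaxMonoidal.μ F A B =
    eqToHom (by rw [obj_eq, obj_eq, hD.tensorObj_eq]) ≫ (toCompletion C).map (embedMu A B) ≫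
      eqToHom (obj_eq (A ⊗ B)).symm

end IntP

end

/-!
A path of arrows of `Int^p(C)` evaluates to a formal trace: a morphism of `C` together with the
wires that remain to be traced out. Call two formal traces equivalent if they have the same partial
value in every context of further morphisms and feedback wires. By the trace axioms, composing a
formal trace with an arrow and tensoring it with an object both amount to putting it into a context,
and a formal trace that has a value is equivalent to this value. Hence `∼`-related paths have
equivalent evaluations, and an arrow of `Int^p(C)` is determined by its class.

An arrow that acts separately on the positive and on the negative wires composes totally with every
other arrow, since the traced wires are straightened by yanking. The structural isomorphisms are of
this kind, so the equations of a compact closed category, as well as those of the embedding of `C`,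
reduce to coherence in `C`. The canonical trace of an embedded morphism `f` is the composite of a
path of length two, whose evaluation is `f` up to structural isomorphisms of its domain, its
codomain and the traced wire; hence it is the class of `g` exactly if the trace of `f` is defined
and equal to `g`.
-/

noncomputable section

/-! ### Coherence for symmetric monoidal categories -/

namespace SymmetricCoherence

/-- Bracketed tensor products of named wires, i.e. the objects of the free symmetric monoidal
category on `ℕ`. -/
inductive Word
  | wire (n : ℕ)
  | one
  | tensor (a b : Word)

/-- The names of the wires of a word, from left to right. -/
def Word.wires : Word → List ℕ
  | .wire n => [n]
  | .one => []
  | .tensor a b => a.wires ++ b.wires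

/-- Formal composites of structural isomorphisms between words, before any coherence equation is
imposed. -/
inductive Structural : Word → Word → Type
  | id (a : Word) : Structural a a
  | comp {a b c : Word} (m : Structural a b) (m' : Structural b c) : Structural a c
  | symm {a b : Word} (m : Structural a b) : Structural b a
  | tensor {a b a' b' : Word} (m : Structural a b) (m' : Structural a' b') :
      Structural (.tensor a a') (.tensor b b')
  | assoc (a b c : Word) : Structural (.tensor (.tensor a b) c) (.tensor a (.tensor b c))
  | leftUnit (a : Word) : Structural (.tensor .one a) a
  | rightUnit (a : Word) : Structural (.tensor a .one) a
  | braid (a b : Word) : Structural (.tensor a b) (.tensor b a)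

theorem Structural.wires_perm {a b : Word} (m : Structural a b) : a.wires.Perm b.wires := by
  induction m with
  | id a => exact .refl _
  | comp _ _ hm hm' => exact hm.trans hm'
  | symm _ hm => exact hm.symm
  | tensor _ _ hm hm' => exact hm.append hm'
  | assoc a b c => simp [Word.wires]
  | leftUnit a => exact .refl _
  | rightUnit a => simp [Word.wires]
  | braid a b => exact List.perm_append_comm

variable {C : Type u} [Category.{v} C] [MonoidalCategory C]

/-- The object of `C` denoted by a word, when wire `n` carries the object `w n`. -/
def Word.eval (w : ℕ → C) : Word → C
  | .wire n => w n
  | .one => 𝟙_ C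
  | .tensor a b => a.eval w ⊗ b.eval w

section ImageTensor

variable {M : Type*} [Category* M] [MonoidalCategory M] (G : M ⥤ C) [G.Monoidal]
  {X Y Z X' Y' : C} {P Q R P' Q' : M}

/-- Presentations of two objects as values of a monoidal functor induce one of their tensor
product. -/
def imageTensor (i : X ≅ G.obj P) (j : Y ≅ G.obj Q) : X ⊗ Y ≅ G.obj (P ⊗ Q) :=
  (i ⊗ᵢ j) ≪≫ Functor.Monoidal.μIso G P Q

open Functor.LaxMonoidal

theorem associator_imageTensor (i : X ≅ G.obj P) (j : Y ≅ G.obj Q) (k : Z ≅ G.obj R) :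
    (α_ X Y Z).hom ≫ (imageTensor G i (imageTensor G j k)).hom =
      (imageTensor G (imageTensor G i j) k).hom ≫ G.map (α_ P Q R).hom := by
  have left_factor : (i.hom ⊗ₘ j.hom) ≫ μ G P Q ⊗ₘ k.hom =
      ((i.hom ⊗ₘ j.hom) ⊗ₘ k.hom) ≫ μ G P Q ▷ G.obj R := by
    rw [← tensorHom_id, tensorHom_comp_tensorHom, Category.comp_id]
  have right_factor : i.hom ⊗ₘ (j.hom ⊗ₘ k.hom) ≫ μ G Q R =
      (i.hom ⊗ₘ (j.hom ⊗ₘ k.hom)) ≫ G.obj P ◁ μ G Q R := by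
    rw [← id_tensorHom, tensorHom_comp_tensorHom, Category.comp_id]
  simp only [imageTensor, Iso.trans_hom, tensorIso_hom, Functor.Monoidal.μIso_hom, left_factor,
    right_factor, Category.assoc, associativity, associator_naturality_assoc]

theorem leftUnitor_imageTensor (i : X ≅ G.obj P) :
    (λ_ X).hom ≫ i.hom =
      (imageTensor G (Functor.Monoidal.εIso G) i).hom ≫ G.map (λ_ P).hom := by
  simp [imageTensor, MonoidalCategory.tensorHom_def']

theorem rightUnitor_imageTensor (i : X ≅ G.obj P) :
    (ρ_ X).hom ≫ i.hom =
      (imageTensor G i (Functor.Monoidal.εIso G)).hom ≫ G.map (ρ_ P).hom := by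
  simp [imageTensor, MonoidalCategory.tensorHom_def]

variable {G} in
theorem tensorHom_imageTensor {i : X ≅ G.obj P} {j : Y ≅ G.obj Q} {i' : X' ≅ G.obj P'}
    {j' : Y' ≅ G.obj Q'} {f : X ⟶ X'} {g : Y ⟶ Y'} {φ : P ⟶ P'} {ψ : Q ⟶ Q'}
    (hf : f ≫ i'.hom = i.hom ≫ G.map φ) (hg : g ≫ j'.hom = j.hom ≫ G.map ψ) :
    (f ⊗ₘ g) ≫ (imageTensor G i' j').hom = (imageTensor G i j).hom ≫ G.map (φ ⊗ₘ ψ) := by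
  simp only [imageTensor, Iso.trans_hom, tensorIso_hom, Functor.Monoidal.μIso_hom, Category.assoc,
    ← μ_natural, tensorHom_comp_tensorHom_assoc, hf, hg]

end ImageTensor

section Coherence

variable [SymmetricCategory C]

/-- The structural isomorphism of `C` denoted by a formal one. -/
def Structural.eval (w : ℕ → C) : ∀ {a b : Word}, Structural a b → (a.eval w ≅ b.eval w)
  | _, _, .id _ => Iso.refl _
  | _, _, .comp m m' => m.eval w ≪≫ m'.eval w
  | _, _, .symm m => (m.eval w).symm
  | _, _, .tensor m m' => m.eval w ⊗ᵢ m'.eval w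
  | _, _, .assoc _ _ _ => α_ _ _ _
  | _, _, .leftUnit _ => λ_ _
  | _, _, .rightUnit _ => ρ_ _
  | _, _, .braid _ _ => β_ _ _

section Splitting

open BraidedCategory in
theorem tensorμ_braiding (X₁ X₂ Y₁ Y₂ : C) :
    (β_ (X₁ ⊗ X₂) (Y₁ ⊗ Y₂)).hom ≫ tensorμ Y₁ Y₂ X₁ X₂ =
      tensorμ X₁ X₂ Y₁ Y₂ ≫ ((β_ X₁ Y₁).hom ⊗ₘ (β_ X₂ Y₂).hom) := by
  simp [tensorμ, SymmetricCategory.braiding_swap_eq_inv_braiding Y₂ X₁,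
    MonoidalCategory.tensorHom_def]

theorem braiding_tensorHom_tensorμ {X X₁ X₂ Y Y₁ Y₂ : C} (f : X ⟶ X₁ ⊗ X₂) (g : Y ⟶ Y₁ ⊗ Y₂) :
    (β_ X Y).hom ≫ (g ⊗ₘ f) ≫ tensorμ Y₁ Y₂ X₁ X₂ =
      ((f ⊗ₘ g) ≫ tensorμ X₁ X₂ Y₁ Y₂) ≫ ((β_ X₁ Y₁).hom ⊗ₘ (β_ X₂ Y₂).hom) := by
  simp only [Category.assoc, ← tensorμ_braiding, BraidedCategory.braiding_naturality_assoc]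

/-- The decomposition of the value of a word induced by decompositions of all its wires. -/
def Word.split {w x y : ℕ → C} (d : ∀ n, w n ≅ x n ⊗ y n) :
    ∀ a : Word, a.eval w ≅ a.eval x ⊗ a.eval y
  | .wire n => d n
  | .one => (λ_ (𝟙_ C)).symm
  | .tensor a b =>
    imageTensor (P := (a.eval x, a.eval y)) (Q := (b.eval x, b.eval y))
      (MonoidalCategory.tensor C) (a.split d) (b.split d)

theorem Structural.eval_split {w x y : ℕ → C} (d : ∀ n, w n ≅ x n ⊗ y n) {a b : Word}
    (m : Structural a b) :
    (m.eval w).hom ≫ (b.split d).hom =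
      (a.split d).hom ≫ ((m.eval x).hom ⊗ₘ (m.eval y).hom) := by
  induction m with
  | id a => simp [Structural.eval]
  | comp m m' hm hm' =>
    simp only [Structural.eval, Iso.trans_hom, Category.assoc, hm', reassoc_of% hm,
      tensorHom_comp_tensorHom]
  | symm m hm =>
    simp only [Structural.eval, Iso.symm_hom, Iso.inv_comp_eq, reassoc_of% hm,
      tensorHom_comp_tensorHom, Iso.hom_inv_id, id_tensorHom_id, Category.comp_id]
  | tensor m m' hm hm' =>
    exact tensorHom_imageTensor (G := MonoidalCategory.tensor C)
      (φ := Prod.mkHom (m.eval x).hom (m.eval y).hom)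
      (ψ := Prod.mkHom (m'.eval x).hom (m'.eval y).hom) hm hm'
  | assoc a b c =>
    exact associator_imageTensor (P := (a.eval x, a.eval y)) (Q := (b.eval x, b.eval y))
      (R := (c.eval x, c.eval y)) (MonoidalCategory.tensor C) _ _ _
  | leftUnit a =>
    exact leftUnitor_imageTensor (P := (a.eval x, a.eval y)) (MonoidalCategory.tensor C) _
  | rightUnit a =>
    exact rightUnitor_imageTensor (P := (a.eval x, a.eval y)) (MonoidalCategory.tensor C) _
  | braid a b => exact braiding_tensorHom_tensorμ _ _

theorem Structural.eval_eq_of_split {w x y : ℕ → C} (d : ∀ n, w n ≅ x n ⊗ y n) {a b : Word}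
    {m m' : Structural a b} (hx : m.eval x = m'.eval x) (hy : m.eval y = m'.eval y) :
    m.eval w = m'.eval w := by
  ext
  rw [← cancel_mono (b.split d).hom, m.eval_split, m'.eval_split, hx, hy]

end Splitting

section SingleWire

variable {M : Type*} [Category* M] [MonoidalCategory M]

theorem braiding_eq_of_iso_unit {X : C} (i : X ≅ 𝟙_ C) (Y : C) :
    (β_ X Y).hom = i.hom ▷ Y ≫ (λ_ Y).hom ≫ (ρ_ Y).inv ≫ Y ◁ i.inv := by
  rw [← braiding_tensorUnit_left_assoc, ← BraidedCategory.braiding_naturality_left,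
    ← comp_whiskerRight_assoc, i.hom_inv_id, id_whiskerRight, Category.id_comp]

open Functor.LaxMonoidal in
theorem braiding_map_of_iso_unit (G : M ⥤ C) [G.Monoidal] {P : M} (i : P ≅ 𝟙_ M) (Q : M) :
    (β_ (G.obj P) (G.obj Q)).hom ≫ μ G Q P =
      μ G P Q ≫ G.map (i.hom ▷ Q ≫ (λ_ Q).hom ≫ (ρ_ Q).inv ≫ Q ◁ i.inv) := by
  rw [braiding_eq_of_iso_unit (G.mapIso i ≪≫ (Functor.Monoidal.εIso G).symm)]
  simp

open Functor.LaxMonoidal in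
theorem exists_braiding_map (G : M ⥤ C) [G.Monoidal] {P Q : M}
    (h : Nonempty (P ≅ 𝟙_ M) ∨ Nonempty (Q ≅ 𝟙_ M)) :
    ∃ φ : P ⊗ Q ≅ Q ⊗ P, (β_ (G.obj P) (G.obj Q)).hom ≫ μ G Q P = μ G P Q ≫ G.map φ.hom := by
  rcases h with ⟨⟨i⟩⟩ | ⟨⟨i⟩⟩
  · exact ⟨whiskerRightIso i Q ≪≫ λ_ Q ≪≫ (ρ_ Q).symm ≪≫ whiskerLeftIso Q i.symm,
      braiding_map_of_iso_unit G i Q⟩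
  · refine ⟨(whiskerRightIso i P ≪≫ λ_ P ≪≫ (ρ_ P).symm ≪≫ whiskerLeftIso P i.symm).symm, ?_⟩
    rw [← cancel_epi (β_ (G.obj Q) (G.obj P)).hom, SymmetricCategory.symmetry_assoc,
      reassoc_of% braiding_map_of_iso_unit G i P]
    simp [← Functor.map_comp]

theorem Word.nonempty_eval_iso_unit {w : ℕ → M} {a : Word} (h : ∀ n ∈ a.wires, w n = 𝟙_ M) :
    Nonempty (a.eval w ≅ 𝟙_ M) := by
  induction a with
  | wire n => exact ⟨eqToIso (h n (List.mem_singleton_self n))⟩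
  | one => exact ⟨Iso.refl _⟩
  | tensor a b ha hb =>
    simp only [Word.wires, List.forall_mem_append] at h
    exact (ha h.1).elim fun i => (hb h.2).elim fun j => ⟨(i ⊗ᵢ j) ≪≫ λ_ _⟩

/-- Presentations of the wires as values of a monoidal functor induce one of every word. -/
def Word.imageIso {w : ℕ → C} (G : M ⥤ C) [G.Monoidal] {p : ℕ → M} (d : ∀ n, w n ≅ G.obj (p n)) :
    ∀ a : Word, a.eval w ≅ G.obj (a.eval p)
  | .wire n => d n
  | .one => Functor.Monoidal.εIso G
  | .tensor a b => imageTensor G (a.imageIso G d) (b.imageIso G d)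

theorem braiding_imageTensor {X Y : C} {P Q : M} {G : M ⥤ C} [G.Monoidal] {i : X ≅ G.obj P}
    {j : Y ≅ G.obj Q} {φ : P ⊗ Q ⟶ Q ⊗ P}
    (hφ : (β_ (G.obj P) (G.obj Q)).hom ≫ Functor.LaxMonoidal.μ G Q P =
      Functor.LaxMonoidal.μ G P Q ≫ G.map φ) :
    (β_ X Y).hom ≫ (imageTensor G j i).hom = (imageTensor G i j).hom ≫ G.map φ := by
  simp only [imageTensor, Iso.trans_hom, tensorIso_hom, Functor.Monoidal.μIso_hom, Category.assoc,
    ← hφ, BraidedCategory.braiding_naturality_assoc]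

-- Of two words without common wires one evaluates to the unit, so all braidings reduce to unitors.
theorem Structural.exists_map_eval {w : ℕ → C} (G : M ⥤ C) [G.Monoidal] {p : ℕ → M}
    (d : ∀ n, w n ≅ G.obj (p n)) (k : ℕ) {a b : Word} (m : Structural a b) (ha : a.wires.Nodup)
    (hp : ∀ n ∈ a.wires, n ≠ k → p n = 𝟙_ M) : ∃ φ : a.eval p ≅ b.eval p,
      (m.eval w).hom ≫ (b.imageIso G d).hom = (a.imageIso G d).hom ≫ G.map φ.hom := by
  induction m with
  | id a =>
    refine ⟨Iso.refl _, ?_⟩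
    simp only [Structural.eval, Iso.refl_hom, Category.id_comp,
      CategoryTheory.Functor.map_id, Category.comp_id]
  | comp m m' hm hm' =>
    obtain ⟨φ, hφ⟩ := hm ha hp
    obtain ⟨ψ, hψ⟩ := hm' (m.wires_perm.nodup_iff.1 ha)
      fun n hn => hp n (m.wires_perm.mem_iff.2 hn)
    exact ⟨φ ≪≫ ψ, by simp [Structural.eval, hψ, reassoc_of% hφ]⟩
  | symm m hm =>
    obtain ⟨φ, hφ⟩ := hm (m.wires_perm.nodup_iff.2 ha)
      fun n hn => hp n (m.wires_perm.mem_iff.1 hn)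
    refine ⟨φ.symm, ?_⟩
    rw [Structural.eval, Iso.symm_hom, Iso.inv_comp_eq, reassoc_of% hφ, ← Functor.map_comp,
      Iso.symm_hom, Iso.hom_inv_id, CategoryTheory.Functor.map_id, Category.comp_id]
  | tensor m m' hm hm' =>
    obtain ⟨φ, hφ⟩ := hm (List.nodup_append.1 ha).1 fun n hn => hp n (List.mem_append_left _ hn)
    obtain ⟨ψ, hψ⟩ := hm' (List.nodup_append.1 ha).2.1 fun n hn => hp n (List.mem_append_right _ hn)
    exact ⟨φ ⊗ᵢ ψ, tensorHom_imageTensor hφ hψ⟩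
  | assoc a b c => exact ⟨α_ _ _ _, associator_imageTensor _ _ _ _⟩
  | leftUnit a => exact ⟨λ_ _, leftUnitor_imageTensor _ _⟩
  | rightUnit a => exact ⟨ρ_ _, rightUnitor_imageTensor _ _⟩
  | braid a b =>
    obtain ⟨hpa, hpb⟩ := List.forall_mem_append.1 hp
    have one_side_unit : Nonempty (a.eval p ≅ 𝟙_ M) ∨ Nonempty (b.eval p ≅ 𝟙_ M) := by
      by_cases hk : k ∈ a.wires
      · refine .inr (Word.nonempty_eval_iso_unit fun n hn => hpb n hn ?_)
        exact fun e => (List.nodup_append.1 ha).2.2 k hk n hn e.symm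
      · exact .inl (Word.nonempty_eval_iso_unit fun n hn => hpa n hn fun e => hk (e ▸ hn))
    obtain ⟨φ, hφ⟩ := exists_braiding_map G one_side_unit
    exact ⟨φ, braiding_imageTensor hφ⟩

-- The morphisms `φ` of `exists_map_eval` live in the free monoidal category, which is thin.
theorem Structural.eval_eq_of_single {w : ℕ → C} (k : ℕ) {a b : Word} (ha : a.wires.Nodup)
    (hw : ∀ n ∈ a.wires, n ≠ k → w n = 𝟙_ C) (m m' : Structural a b) :
    m.eval w = m'.eval w := by
  classical
  let G := FreeMonoidalCategory.project w
  let p : ℕ → FreeMonoidalCategory ℕ := fun n => if w n = 𝟙_ C then 𝟙_ _ else .of n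
  let d (n : ℕ) : w n ≅ G.obj (p n) := eqToIso <| by
    by_cases h : w n = 𝟙_ C
    · rw [show p n = 𝟙_ _ from if_pos h, h]; rfl
    · rw [show p n = .of n from if_neg h]; rfl
  have hp (n) (hn : n ∈ a.wires) (hk : n ≠ k) : p n = 𝟙_ _ := if_pos (hw n hn hk)
  obtain ⟨φ, hφ⟩ := m.exists_map_eval G d k ha hp
  obtain ⟨ψ, hψ⟩ := m'.exists_map_eval G d k ha hp
  ext
  rw [← cancel_mono (b.imageIso G d).hom, hφ, hψ, Subsingleton.elim φ.hom ψ.hom]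

end SingleWire

-- Every wire is a tensor product with the unit, which allows treating one wire at a time.
theorem Structural.eval_eq {a b : Word} (ha : a.wires.Nodup) (w : ℕ → C)
    (m m' : Structural a b) : m.eval w = m'.eval w := by
  suffices ∀ (l : List ℕ) (w : ℕ → C), (∀ n ∈ a.wires, n ∉ l → w n = 𝟙_ C) →
      m.eval w = m'.eval w from this a.wires w fun n hn h => absurd hn h
  intro l
  induction l with
  | nil => exact fun w hw => eval_eq_of_single 0 ha (fun n hn _ => hw n hn List.not_mem_nil) m m'
  | cons k l ih =>
    intro w hw
    let x (n : ℕ) : C := if n = k then w n else 𝟙_ C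
    let y (n : ℕ) : C := if n = k then 𝟙_ C else w n
    have d (n : ℕ) : w n ≅ x n ⊗ y n := by
      by_cases h : n = k
      · simpa only [x, y, if_pos h] using (ρ_ (w n)).symm
      · simpa only [x, y, if_neg h] using (λ_ (w n)).symm
    refine eval_eq_of_split d (eval_eq_of_single k ha (fun n _ h => if_neg h) m m') (ih y ?_)
    intro n hn hl
    by_cases h : n = k
    · exact if_pos h
    · exact (if_neg h).trans (hw n hn (by simp [h, hl]))

end Coherence

section NormalForm

/-- The right-bracketed word with a given list of wires. -/
def Word.ofList : List ℕ → Word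
  | [] => .one
  | n :: l => .tensor (.wire n) (.ofList l)

theorem Word.wires_ofList (l : List ℕ) : (Word.ofList l).wires = l := by
  induction l with
  | nil => rfl
  | cons n l ih => exact congrArg (n :: ·) ih

/-- The formal exchange of the first two of three factors. -/
def Structural.exchange (a b c : Word) :
    Structural (.tensor a (.tensor b c)) (.tensor b (.tensor a c)) :=
  .comp (.comp (.symm (.assoc _ _ _)) (.tensor (.braid _ _) (.id _))) (.assoc _ _ _)

theorem Structural.nonempty_ofList_append (l l' : List ℕ) :
    Nonempty (Structural (.tensor (.ofList l) (.ofList l')) (.ofList (l ++ l'))) := by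
  induction l with
  | nil => exact ⟨.leftUnit _⟩
  | cons n l ih => exact ih.elim fun m => ⟨.comp (.assoc _ _ _) (.tensor (.id _) m)⟩

theorem Structural.nonempty_ofList_wires (a : Word) :
    Nonempty (Structural a (.ofList a.wires)) := by
  induction a with
  | wire n => exact ⟨.symm (.rightUnit _)⟩
  | one => exact ⟨.id _⟩
  | tensor a b ha hb =>
    obtain ⟨m⟩ := ha
    obtain ⟨m'⟩ := hb
    obtain ⟨m''⟩ := nonempty_ofList_append a.wires b.wires
    exact ⟨.comp (.tensor m m') m''⟩

theorem Structural.nonempty_ofList_of_perm {l l' : List ℕ} (h : l.Perm l') :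
    Nonempty (Structural (.ofList l) (.ofList l')) := by
  induction h with
  | nil => exact ⟨.id _⟩
  | cons n _ hm => exact hm.elim fun m => ⟨.tensor (.id _) m⟩
  | swap m n l => exact ⟨.exchange _ _ _⟩
  | trans _ _ hm hm' => exact hm.elim fun m => hm'.elim fun m' => ⟨.comp m m'⟩

theorem Structural.nonempty_iff_perm {a b : Word} :
    Nonempty (Structural a b) ↔ a.wires.Perm b.wires := by
  refine ⟨fun ⟨m⟩ => m.wires_perm, fun h => ?_⟩
  obtain ⟨m⟩ := nonempty_ofList_wires a
  obtain ⟨m'⟩ := nonempty_ofList_of_perm h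
  obtain ⟨m''⟩ := nonempty_ofList_wires b
  exact ⟨.comp m (.comp m' (.symm m''))⟩

end NormalForm

/-! ### String diagrams -/

/-- A morphism with named input wires `dom` and output wires `cod`. -/
structure Box (w : ℕ → C) where
  dom : Word
  cod : Word
  hom : dom.eval w ⟶ cod.eval w

/-- The names of all wires of a string diagram with input wires `a` and boxes `L`. -/
def diagramWires {w : ℕ → C} (a : Word) (L : List (Box w)) : List ℕ :=
  a.wires ++ L.flatMap fun x => x.cod.wires

section DiagramWires

variable {w : ℕ → C} {a r : Word} {L L' : List (Box w)} {x : Box w}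

theorem diagramWires_perm (a : Word) (h : L.Perm L') :
    (diagramWires a L).Perm (diagramWires a L') :=
  (h.flatMap_right _).append_left _

theorem diagramWires_cons_perm (m : Structural a (.tensor x.dom r)) :
    (diagramWires a (x :: L)).Perm (x.dom.wires ++ diagramWires (.tensor x.cod r) L) := by
  refine (m.wires_perm.append_right _).trans ?_
  simp only [diagramWires, Word.wires, List.flatMap_cons, List.append_assoc]
  refine .append_left _ ?_
  simp only [← List.append_assoc]
  exact List.perm_append_comm.append_right _

theorem nodup_diagramWires_of_cons (m : Structural a (.tensor x.dom r))
    (h : (diagramWires a (x :: L)).Nodup) : (diagramWires (.tensor x.cod r) L).Nodup :=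
  (List.nodup_append.1 ((diagramWires_cons_perm m).nodup_iff.1 h)).2.1

end DiagramWires

variable [SymmetricCategory C]

section Exchange

variable (X Y S : C)

/-- Exchange of the first two of three factors. -/
def exchange : X ⊗ (Y ⊗ S) ≅ Y ⊗ (X ⊗ S) :=
  ((α_ X Y S).symm ≪≫ (β_ X Y ⊗ᵢ Iso.refl S)) ≪≫ α_ Y X S

theorem exchange_exchange : (exchange X Y S).hom ≫ (exchange Y X S).hom = 𝟙 _ := by
  simp [exchange, ← comp_whiskerRight_assoc]

variable {X Y S} {X' Y' : C}

theorem exchange_naturality_left (f : X ⟶ X') :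
    f ▷ (Y ⊗ S) ≫ (exchange X' Y S).hom = (exchange X Y S).hom ≫ Y ◁ f ▷ S := by
  have braided : f ▷ Y ▷ S ≫ (β_ X' Y).hom ▷ S = (β_ X Y).hom ▷ S ≫ (Y ◁ f) ▷ S := by
    simp only [← comp_whiskerRight, BraidedCategory.braiding_naturality_left]
  simp [exchange, reassoc_of% braided]

theorem whiskerRight_exchange_whiskerRight (f : X ⟶ X') (g : Y ⟶ Y') :
    f ▷ (Y ⊗ S) ≫ (exchange X' Y S).hom ≫ g ▷ (X' ⊗ S) =
      (exchange X Y S).hom ≫ g ▷ (X ⊗ S) ≫ (exchange Y' X S).hom ≫ f ▷ (Y' ⊗ S) ≫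
        (exchange X' Y' S).hom := by
  rw [reassoc_of% exchange_naturality_left f, exchange_naturality_left f,
    reassoc_of% exchange_exchange Y' X S, whisker_exchange]

end Exchange

/-- `Run w L a b f` states that `f` is obtained by applying the boxes of `L` one after the other,
up to structural isomorphisms. -/
inductive Run (w : ℕ → C) : List (Box w) → ∀ a b : Word, (a.eval w ⟶ b.eval w) → Prop
  | nil {a b : Word} (m : Structural a b) : Run w [] a b (m.eval w).hom
  | cons {a b r : Word} {x : Box w} {L : List (Box w)} (m : Structural a (.tensor x.dom r))
      {f : (Word.tensor x.cod r).eval w ⟶ b.eval w} (hf : Run w L (.tensor x.cod r) b f) :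
      Run w (x :: L) a b ((m.eval w).hom ≫ x.hom ▷ r.eval w ≫ f)

namespace Run

variable {w : ℕ → C} {a b c r s : Word} {L L' : List (Box w)} {x y : Box w}

theorem structural_comp (m : Structural a b) {f : b.eval w ⟶ c.eval w} (hf : Run w L b c f) :
    Run w L a c ((m.eval w).hom ≫ f) := by
  cases hf with
  | nil m' => exact .nil (.comp m m')
  | cons m' hf =>
    rw [← Category.assoc]
    exact .cons (.comp m m') hf

theorem comp {f : a.eval w ⟶ b.eval w} {g : b.eval w ⟶ c.eval w} (hf : Run w L a b f)
    (hg : Run w L' b c g) : Run w (L ++ L') a c (f ≫ g) := by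
  induction hf with
  | nil m => exact hg.structural_comp m
  | cons m _ ih =>
    have reassociate {A X Y B D : C} (m : A ⟶ X) (x : X ⟶ Y) (f : Y ⟶ B) (g : B ⟶ D) :
        (m ≫ x ≫ f) ≫ g = m ≫ x ≫ f ≫ g := by simp
    exact (reassociate _ _ _ _).symm ▸ .cons m (ih hg)

theorem whiskerRight {f : a.eval w ⟶ b.eval w} (hf : Run w L a b f) (c : Word) :
    Run w L (.tensor a c) (.tensor b c) (f ▷ c.eval w) := by
  induction hf with
  | nil m =>
    rw [← tensorHom_id]
    exact .nil (.tensor m (.id c))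
  | @cons a b r x L m f _ ih =>
    have move_bracket {A X Y R B : C} (m : A ⟶ X ⊗ R) (x : X ⟶ Y) (f : Y ⊗ R ⟶ B) (D : C) :
        (m ≫ x ▷ R ≫ f) ▷ D =
          ((m ⊗ₘ 𝟙 D) ≫ (α_ _ _ _).hom) ≫ x ▷ (R ⊗ D) ≫ (α_ _ _ _).inv ≫ f ▷ D := by
      simp
    exact (move_bracket _ _ _ _).symm ▸ .cons (.comp (.tensor m (.id c)) (.assoc _ _ _))
      (ih.structural_comp (.symm (.assoc _ _ _)))

theorem whiskerLeft {f : a.eval w ⟶ b.eval w} (hf : Run w L a b f) (c : Word) :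
    Run w L (.tensor c a) (.tensor c b) (c.eval w ◁ f) := by
  have conj_braiding {A B D : C} (f : A ⟶ B) :
      D ◁ f = (β_ D A).hom ≫ f ▷ D ≫ (β_ B D).hom := by simp
  have hfc := ((hf.whiskerRight c).comp (.nil (.braid b c))).structural_comp (.braid c a)
  rw [List.append_nil] at hfc
  exact (conj_braiding f).symm ▸ hfc

theorem box (x : Box w) : Run w [x] x.dom x.cod x.hom := by
  have conj_rightUnitor {X Y : C} (f : X ⟶ Y) : f = (ρ_ X).inv ≫ f ▷ 𝟙_ C ≫ (ρ_ Y).hom := by simp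
  rw [conj_rightUnitor x.hom]
  exact .cons (.symm (.rightUnit x.dom)) (.nil (.rightUnit x.cod))

theorem exists_of_cons {f : a.eval w ⟶ b.eval w} (hf : Run w (x :: L) a b f)
    (m : Structural a (.tensor x.dom r)) (ha : a.wires.Nodup) :
    ∃ g : (Word.tensor x.cod r).eval w ⟶ b.eval w, Run w L (.tensor x.cod r) b g ∧
      f = (m.eval w).hom ≫ x.hom ▷ r.eval w ≫ g := by
  cases hf with
  | @cons _ _ r' _ _ m' g hg =>
    have rest_perm : (x.dom.wires ++ r.wires).Perm (x.dom.wires ++ r'.wires) :=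
      m.wires_perm.symm.trans m'.wires_perm
    obtain ⟨t⟩ := Structural.nonempty_iff_perm.2 ((List.perm_append_left_iff _).1 rest_perm)
    refine ⟨_, hg.structural_comp (.tensor (.id _) t), ?_⟩
    rw [Structural.eval_eq ha w m' (.comp m (.tensor (.id _) t))]
    have slide {A X Y R R' B : C} (m : A ⟶ X ⊗ R) (x : X ⟶ Y) (t : R ⟶ R') (g : Y ⊗ R' ⟶ B) :
        (m ≫ (𝟙 X ⊗ₘ t)) ≫ x ▷ R' ≫ g = m ≫ x ▷ R ≫ (𝟙 Y ⊗ₘ t) ≫ g := by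
      simp [whisker_exchange_assoc]
    exact slide _ _ _ _

theorem unique {f g : a.eval w ⟶ b.eval w} (hf : Run w L a b f) (hg : Run w L a b g)
    (h : (diagramWires a L).Nodup) : f = g := by
  induction hf with
  | nil m =>
    cases hg with
    | nil m' => rw [m.eval_eq (List.nodup_append.1 h).1 w m']
  | cons m _ ih =>
    obtain ⟨g', hg', rfl⟩ := hg.exists_of_cons m (List.nodup_append.1 h).1
    rw [ih hg' (nodup_diagramWires_of_cons m h)]

theorem exists_structural_tensor_tensor {f : a.eval w ⟶ b.eval w}
    (hf : Run w (x :: y :: L) a b f) (hxy : y.dom.wires.Disjoint x.cod.wires)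
    (h : (diagramWires a (x :: y :: L)).Nodup) :
    ∃ s : Word, Nonempty (Structural a (.tensor x.dom (.tensor y.dom s))) := by
  cases hf with
  | @cons _ _ r _ _ m _ hf =>
    cases hf with
    | @cons _ _ r' _ _ m' _ hf =>
      have hperm : (x.cod.wires ++ r.wires).Perm (y.dom.wires ++ r'.wires) := m'.wires_perm
      have dom_subset : y.dom.wires ⊆ r.wires := fun n hn =>
        (List.mem_append.1 (hperm.symm.subset (List.mem_append_left _ hn))).resolve_left (hxy hn)
      have dom_nodup : y.dom.wires.Nodup :=
        (List.nodup_append.1 (hperm.nodup_iff.1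
          (List.nodup_append.1 (nodup_diagramWires_of_cons m h)).1)).1
      obtain ⟨k, hk, k_sublist⟩ := List.subperm_of_subset dom_nodup dom_subset
      obtain ⟨l, hl⟩ := k_sublist.exists_perm_append
      refine ⟨.ofList l, Structural.nonempty_iff_perm.2 (m.wires_perm.trans ?_)⟩
      simpa only [Word.wires, Word.wires_ofList] using (hl.trans (hk.append_right l)).append_left _

theorem swap {f : a.eval w ⟶ b.eval w} (hf : Run w (x :: y :: L) a b f)
    (hxy : y.dom.wires.Disjoint x.cod.wires) (h : (diagramWires a (x :: y :: L)).Nodup) :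
    Run w (y :: x :: L) a b f := by
  obtain ⟨s, ⟨m⟩⟩ := hf.exists_structural_tensor_tensor hxy h
  obtain ⟨f', hf', rfl⟩ := hf.exists_of_cons m (List.nodup_append.1 h).1
  obtain ⟨g, hg, rfl⟩ := hf'.exists_of_cons (.exchange x.cod y.dom s)
    (List.nodup_append.1 (nodup_diagramWires_of_cons m h)).1
  have hswap : Run w (y :: x :: L) a b _ := .cons (.comp m (.exchange x.dom y.dom s))
    (.cons (.exchange y.cod x.dom s) (hg.structural_comp (.exchange x.cod y.cod s)))
  have interchange {A X X' Y Y' S B : C} (m : A ⟶ X ⊗ (Y ⊗ S)) (x : X ⟶ X') (y : Y ⟶ Y')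
      (g : Y' ⊗ (X' ⊗ S) ⟶ B) :
      m ≫ x ▷ (Y ⊗ S) ≫ (exchange X' Y S).hom ≫ y ▷ (X' ⊗ S) ≫ g =
        (m ≫ (exchange X Y S).hom) ≫ y ▷ (X ⊗ S) ≫ (exchange Y' X S).hom ≫ x ▷ (Y' ⊗ S) ≫
          (exchange X' Y' S).hom ≫ g := by
    rw [reassoc_of% whiskerRight_exchange_whiskerRight x y, Category.assoc]
  exact (interchange _ _ _ _).symm ▸ hswap

theorem move_to_front {K : List (Box w)} {f : a.eval w ⟶ b.eval w}
    (hf : Run w (K ++ x :: L) a b f) (hx : ∀ y ∈ K, x.dom.wires.Disjoint y.cod.wires)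
    (h : (diagramWires a (K ++ x :: L)).Nodup) : Run w (x :: (K ++ L)) a b f := by
  induction K generalizing a with
  | nil => exact hf
  | cons y K ih =>
    rw [List.cons_append] at hf h
    obtain ⟨hy, hK⟩ := List.forall_mem_cons.1 hx
    have hyx : Run w (y :: x :: (K ++ L)) a b f := by
      cases hf with
      | cons m hf => exact .cons m (ih hf hK (nodup_diagramWires_of_cons m h))
    exact hyx.swap hy ((diagramWires_perm a (List.perm_middle.cons y)).nodup_iff.1 h)

theorem unique_of_perm {f g : a.eval w ⟶ b.eval w} (hf : Run w L a b f) (hg : Run w L' a b g)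
    (hL : L.Perm L') (h : (diagramWires a L).Nodup) : f = g := by
  induction hf generalizing L' with
  | nil m => exact unique (.nil m) (hL.nil_eq ▸ hg) h
  | @cons a b r x L m f _ ih =>
    obtain ⟨K, K', rfl⟩ := List.append_of_mem (hL.subset List.mem_cons_self)
    have x_first : Run w (x :: (K ++ K')) a b g := by
      refine hg.move_to_front (fun y hy n hn hn' => ?_)
        ((diagramWires_perm a hL).nodup_iff.1 h)
      have hna : n ∈ a.wires := m.wires_perm.mem_iff.2 (List.mem_append_left _ hn)
      have hnK : n ∈ (K ++ x :: K').flatMap fun x => x.cod.wires :=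
        List.mem_flatMap.2 ⟨y, List.mem_append_left _ hy, hn'⟩
      exact (List.nodup_append.1 ((diagramWires_perm a hL).nodup_iff.1 h)).2.2 n hna n hnK rfl
    obtain ⟨g', hg', rfl⟩ := x_first.exists_of_cons m (List.nodup_append.1 h).1
    rw [ih hg' (hL.trans List.perm_middle).cons_inv (nodup_diagramWires_of_cons m h)]

end Run
/-! ### Reification of string diagrams -/

/-- The assignment of objects to wires given by a list. -/
def wireOf (l : List C) (n : ℕ) : C := l.getD n (𝟙_ C)

/-- The code `a` denotes the object `X`. -/
class Denotes (l : List C) (a : Word) (X : C) : Prop where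
  eq : X = a.eval (wireOf l)

namespace Denotes

variable {l : List C}

instance one : Denotes l .one (𝟙_ C) := ⟨rfl⟩

instance tensor {a b : Word} {X Y : C} [hX : Denotes l a X] [hY : Denotes l b Y] :
    Denotes l (.tensor a b) (X ⊗ Y) := ⟨congrArg₂ _ hX.eq hY.eq⟩

instance zero {X : C} : Denotes (X :: l) (.wire 0) X := ⟨rfl⟩

instance succ {X Y : C} {n : ℕ} [h : Denotes l (.wire n) X] : Denotes (Y :: l) (.wire (n + 1)) X :=
  ⟨h.eq⟩

end Denotes

/-- `f` is the string diagram with input wires `a`, boxes `L` and output wires `b`. -/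
class Diagram (l : List C) (a : Word) (L : outParam (List (Box (wireOf l)))) (b : outParam Word)
    {X Y : C} (f : X ⟶ Y) : Prop where
  dom_eq : X = a.eval (wireOf l)
  cod_eq : Y = b.eval (wireOf l)
  run : Run (wireOf l) L a b (eqToHom dom_eq.symm ≫ f ≫ eqToHom cod_eq)

namespace Diagram

variable {l : List C} {L L' : List (Box (wireOf l))} {a b c a' b' : Word} {X Y Z W : C}

instance id [h : Denotes l a X] : Diagram l a [] a (𝟙 X) where
  dom_eq := h.eq
  cod_eq := h.eq
  run := by
    rw [Category.id_comp, eqToHom_trans, eqToHom_refl]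
    exact .nil (.id a)

instance comp {f : X ⟶ Y} {g : Y ⟶ Z} [hf : Diagram l a L b f] [hg : Diagram l b L' c g] :
    Diagram l a (L ++ L') c (f ≫ g) where
  dom_eq := hf.dom_eq
  cod_eq := hg.cod_eq
  run := by simpa using hf.run.comp hg.run

theorem of_eval {f : a.eval (wireOf l) ⟶ b.eval (wireOf l)} (h : Run _ L a b f) :
    Diagram l a L b f := ⟨rfl, rfl, by simpa using h⟩

theorem exists_eval {f : X ⟶ Y} (h : Diagram l a L b f)
    {P : ∀ {X Y : C}, (X ⟶ Y) → Prop}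
    (hP : ∀ f : a.eval (wireOf l) ⟶ b.eval (wireOf l), Run _ L a b f → P f) : P f := by
  obtain ⟨rfl, rfl, h⟩ := h
  exact hP f (by simpa using h)

instance whiskerRight {f : X ⟶ Y} [hf : Diagram l a L b f] [hZ : Denotes l c Z] :
    Diagram l (.tensor a c) L (.tensor b c) (f ▷ Z) := by
  obtain ⟨rfl⟩ := hZ
  exact hf.exists_eval (P := fun f => Diagram l (.tensor a c) L (.tensor b c) (f ▷ _))
    fun f h => of_eval (h.whiskerRight c)

instance whiskerLeft {f : X ⟶ Y} [hf : Diagram l a L b f] [hZ : Denotes l c Z] :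
    Diagram l (.tensor c a) L (.tensor c b) (Z ◁ f) := by
  obtain ⟨rfl⟩ := hZ
  exact hf.exists_eval (P := fun f => Diagram l (.tensor c a) L (.tensor c b) (_ ◁ f))
    fun f h => of_eval (h.whiskerLeft c)

instance tensor {f : X ⟶ Y} {g : Z ⟶ W} [hf : Diagram l a L b f] [hg : Diagram l a' L' b' g] :
    Diagram l (.tensor a a') (L ++ L') (.tensor b b') (f ⊗ₘ g) := by
  have := Denotes.mk hf.cod_eq
  have := Denotes.mk hg.dom_eq
  rw [MonoidalCategory.tensorHom_def]
  infer_instance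

theorem structural (m : Structural a b) : Diagram l a [] b (m.eval (wireOf l)).hom :=
  of_eval (.nil m)

section

variable [hX : Denotes l a X] [hY : Denotes l b Y] [hZ : Denotes l c Z]

instance assoc_hom :
    Diagram l (.tensor (.tensor a b) c) [] (.tensor a (.tensor b c)) (α_ X Y Z).hom := by
  obtain ⟨rfl⟩ := hX; obtain ⟨rfl⟩ := hY; obtain ⟨rfl⟩ := hZ
  exact structural (.assoc a b c)

instance assoc_inv :
    Diagram l (.tensor a (.tensor b c)) [] (.tensor (.tensor a b) c) (α_ X Y Z).inv := by
  obtain ⟨rfl⟩ := hX; obtain ⟨rfl⟩ := hY; obtain ⟨rfl⟩ := hZ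
  exact structural (.symm (.assoc a b c))

instance leftUnit_hom : Diagram l (.tensor .one a) [] a (λ_ X).hom := by
  obtain ⟨rfl⟩ := hX
  exact structural (.leftUnit a)

instance leftUnit_inv : Diagram l a [] (.tensor .one a) (λ_ X).inv := by
  obtain ⟨rfl⟩ := hX
  exact structural (.symm (.leftUnit a))

instance rightUnit_hom : Diagram l (.tensor a .one) [] a (ρ_ X).hom := by
  obtain ⟨rfl⟩ := hX
  exact structural (.rightUnit a)

instance rightUnit_inv : Diagram l a [] (.tensor a .one) (ρ_ X).inv := by
  obtain ⟨rfl⟩ := hX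
  exact structural (.symm (.rightUnit a))

instance braid_hom : Diagram l (.tensor a b) [] (.tensor b a) (β_ X Y).hom := by
  obtain ⟨rfl⟩ := hX; obtain ⟨rfl⟩ := hY
  exact structural (.braid a b)

instance braid_inv : Diagram l (.tensor b a) [] (.tensor a b) (β_ X Y).inv := by
  obtain ⟨rfl⟩ := hX; obtain ⟨rfl⟩ := hY
  exact structural (.symm (.braid a b))

end

section

variable [MonoidalCoherence X Y]

instance monoidalComp {f : W ⟶ X} {g : Y ⟶ Z} {d : Word} {L'' : List (Box (wireOf l))}
    [Diagram l a L b f] [Diagram l b L' c (⊗𝟙 : X ≅ Y).hom] [Diagram l c L'' d g] :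
    Diagram l a (L ++ (L' ++ L'')) d (f ⊗≫ g) :=
  inferInstanceAs (Diagram l a _ d (f ≫ (⊗𝟙 : X ≅ Y).hom ≫ g))

instance coherence_refl [Denotes l a X] :
    Diagram l a [] a (MonoidalCoherence.iso (self := .refl X)).hom :=
  inferInstanceAs (Diagram l a [] a (𝟙 X))

instance coherence_whiskerLeft [Denotes l c Z] [Diagram l a L b (⊗𝟙 : X ≅ Y).hom] :
    Diagram l (.tensor c a) L (.tensor c b)
      (MonoidalCoherence.iso (self := .whiskerLeft Z X Y)).hom :=
  inferInstanceAs (Diagram l _ L _ (Z ◁ (⊗𝟙 : X ≅ Y).hom))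

instance coherence_whiskerRight [Denotes l c Z] [Diagram l a L b (⊗𝟙 : X ≅ Y).hom] :
    Diagram l (.tensor a c) L (.tensor b c)
      (MonoidalCoherence.iso (self := .whiskerRight X Y Z)).hom :=
  inferInstanceAs (Diagram l _ L _ ((⊗𝟙 : X ≅ Y).hom ▷ Z))

end

instance coherence_assoc [MonoidalCoherence (X ⊗ (Y ⊗ Z)) W] {d : Word} [Denotes l a X]
    [Denotes l b Y] [Denotes l c Z]
    [Diagram l (.tensor a (.tensor b c)) L d (⊗𝟙 : X ⊗ (Y ⊗ Z) ≅ W).hom] :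
    Diagram l (.tensor (.tensor a b) c) ([] ++ L) d
      (MonoidalCoherence.iso (self := .assoc X Y Z W)).hom :=
  inferInstanceAs (Diagram l _ _ _ ((α_ X Y Z).hom ≫ (⊗𝟙 : X ⊗ (Y ⊗ Z) ≅ W).hom))

instance coherence_assoc' [MonoidalCoherence W (X ⊗ (Y ⊗ Z))] {d : Word} [Denotes l a X]
    [Denotes l b Y] [Denotes l c Z]
    [Diagram l d L (.tensor a (.tensor b c)) (⊗𝟙 : W ≅ X ⊗ (Y ⊗ Z)).hom] :
    Diagram l d (L ++ []) (.tensor (.tensor a b) c)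
      (MonoidalCoherence.iso (self := .assoc' W X Y Z)).hom :=
  inferInstanceAs (Diagram l _ _ _ ((⊗𝟙 : W ≅ X ⊗ (Y ⊗ Z)).hom ≫ (α_ X Y Z).inv))

instance coherence_left [MonoidalCoherence X Y] [Denotes l a X]
    [Diagram l a L b (⊗𝟙 : X ≅ Y).hom] :
    Diagram l (.tensor .one a) ([] ++ L) b (MonoidalCoherence.iso (self := .left X Y)).hom :=
  inferInstanceAs (Diagram l _ _ _ ((λ_ X).hom ≫ (⊗𝟙 : X ≅ Y).hom))

instance coherence_right' [MonoidalCoherence X Y] [Denotes l b Y]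
    [Diagram l a L b (⊗𝟙 : X ≅ Y).hom] :
    Diagram l a (L ++ []) (.tensor b .one) (MonoidalCoherence.iso (self := .right' X Y)).hom :=
  inferInstanceAs (Diagram l _ _ _ ((⊗𝟙 : X ≅ Y).hom ≫ (ρ_ Y).inv))

theorem box (l : List C) (a b : Word) {X Y : C} (f : X ⟶ Y) [hX : Denotes l a X]
    [hY : Denotes l b Y] :
    Diagram l a [⟨a, b, eqToHom hX.eq.symm ≫ f ≫ eqToHom hY.eq⟩] b f :=
  ⟨hX.eq, hY.eq, Run.box ⟨a, b, eqToHom hX.eq.symm ≫ f ≫ eqToHom hY.eq⟩⟩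

/-- Used as `exact Diagram.eq l a`, with an instance `Diagram.box l …` in scope for each box: both
sides of the goal are then read as string diagrams by instance resolution. -/
theorem eq (l : List C) (a : Word) {L L' : List (Box (wireOf l))} {b b' : Word} {X Y : C}
    {f g : X ⟶ Y} [hf : Diagram l a L b f] [hg : Diagram l a L' b' g]
    (hL : L.Perm L' := by exact .refl _) (hb : b = b' := by rfl)
    (h : (diagramWires a L).Nodup := by exact of_decide_eq_true rfl) : f = g := by
  subst hb
  exact (cancel_mono _).1 ((cancel_epi _).1 (hf.run.unique_of_perm hg.run hL h))

end Diagram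

end SymmetricCoherence

infixr:70 "⊠" => SymmetricCoherence.Word.tensor
prefix:max "♯" => SymmetricCoherence.Word.wire

open SymmetricCoherence

-- A composite of `n` morphisms is read by a nested instance problem with more than `n` subproblems.
set_option synthInstance.maxSize 2000

variable {C : Type u} [Category.{v} C] [MonoidalCategory C]

/-! ### Formal traces -/

namespace PartialTrace

variable [SymmetricCategory C] [PartialTrace C] {A B U : C} {f : A ⊗ U ⟶ B ⊗ U} {t : A ⟶ B}

theorem mem_tr_comp {A' B' : C} (ht : t ∈ tr U f) (g : A' ⟶ A) (h : B ⟶ B') :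
    g ≫ t ≫ h ∈ tr U (g ▷ U ≫ f ≫ h ▷ U) :=
  naturality f g h _ (Part.mem_map _ ht)

theorem mem_tr_whiskerLeft (ht : t ∈ tr U f) (X : C) :
    X ◁ t ∈ tr U ((α_ X A U).hom ≫ X ◁ f ≫ (α_ X B U).inv) := by
  have h := strength f (𝟙 X) _ (Part.mem_map _ ht)
  rwa [id_tensorHom, id_tensorHom] at h

theorem mem_tr_of_yanking {X : C} (g : A ⟶ X ⊗ U) (h : X ⊗ U ⟶ B) (ht : t = g ≫ h)
    (hf : f = g ▷ U ≫ ((α_ X U U).hom ≫ X ◁ (β_ U U).hom ≫ (α_ X U U).inv) ≫ h ▷ U) :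
    t ∈ tr U f := by
  have yank : 𝟙 U ∈ tr U (β_ U U).hom := yanking U ▸ Part.mem_some _
  simpa [ht, hf] using mem_tr_comp (mem_tr_whiskerLeft yank X) g h

end PartialTrace

/-- A morphism `A ⊗ U ⟶ B ⊗ U`, regarded as an unevaluated trace `A ⟶ B` over `U = obj`. -/
structure FormalTrace (A B : C) where
  obj : C
  hom : A ⊗ obj ⟶ B ⊗ obj

namespace FormalTrace

variable {A B A' B' X Z : C}

/-- The formal trace obtained by surrounding `F` with `k` and `l` and tracing out a further wire
`Z` that leads from `l` back to `k`. -/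
def ctx (k : A' ⊗ Z ⟶ X ⊗ A) (l : X ⊗ B ⟶ B' ⊗ Z) (F : FormalTrace A B) : FormalTrace A' B' :=
  ⟨Z ⊗ F.obj, (α_ _ _ _).inv ≫ (k ▷ F.obj ≫ (α_ _ _ _).hom ≫ X ◁ F.hom ≫ (α_ _ _ _).inv ≫
    l ▷ F.obj) ≫ (α_ _ _ _).hom⟩

/-- The formal trace obtained by surrounding `F` with `k` and `l`, without further feedback. -/
def wrap (k : A' ⟶ X ⊗ A) (l : X ⊗ B ⟶ B') (F : FormalTrace A B) : FormalTrace A' B' :=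
  ⟨F.obj, k ▷ F.obj ≫ (α_ _ _ _).hom ≫ X ◁ F.hom ≫ (α_ _ _ _).inv ≫ l ▷ F.obj⟩

variable [SymmetricCategory C] [PartialTrace C]

open PartialTrace

/-- The partial value of a formal trace. -/
def trace (F : FormalTrace A B) : Part (A ⟶ B) := tr F.obj F.hom

/-- Contextual equivalence of formal traces. Equality of values is too weak to be preserved by
composition, as a context may have a value although the formal trace in it has none. -/
def Equiv (F G : FormalTrace A B) : Prop :=
  ∀ ⦃A' B' Z X : C⦄ (k : A' ⊗ Z ⟶ X ⊗ A) (l : X ⊗ B ⟶ B' ⊗ Z),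
    (F.ctx k l).trace = (G.ctx k l).trace

theorem Equiv.refl (F : FormalTrace A B) : F.Equiv F := fun _ _ _ _ _ _ => rfl

theorem Equiv.symm {F G : FormalTrace A B} (h : F.Equiv G) : G.Equiv F :=
  fun _ _ _ _ k l => (h k l).symm

theorem Equiv.trans {F G H : FormalTrace A B} (h : F.Equiv G) (h' : G.Equiv H) : F.Equiv H :=
  fun _ _ _ _ k l => (h k l).trans (h' k l)

theorem trace_eq_of_conj {F G : FormalTrace A B} (φ : F.obj ≅ G.obj)
    (h : F.hom ≫ B ◁ φ.hom = A ◁ φ.hom ≫ G.hom) : F.trace = G.trace := by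
  have hG : G.hom = (A ◁ φ.inv ≫ F.hom) ≫ B ◁ φ.hom := by
    rw [Category.assoc, h, whiskerLeft_inv_hom_assoc]
  rw [trace, trace, hG, dinaturality, whiskerLeft_hom_inv_assoc]

theorem Equiv.of_conj {F G : FormalTrace A B} (φ : F.obj ≅ G.obj)
    (h : F.hom ≫ B ◁ φ.hom = A ◁ φ.hom ≫ G.hom) : F.Equiv G := by
  intro A' B' Z X k l
  refine trace_eq_of_conj (whiskerLeftIso Z φ) ?_
  change _ ≫ B' ◁ Z ◁ φ.hom = A' ◁ Z ◁ φ.hom ≫ _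
  dsimp only [ctx]
  trans (α_ _ _ _).inv ≫ k ▷ F.obj ≫ (α_ _ _ _).hom ≫ X ◁ (F.hom ≫ B ◁ φ.hom) ≫ (α_ _ _ _).inv ≫
    l ▷ G.obj ≫ (α_ _ _ _).hom
  · let w : List C := [A', Z, F.obj, X, A, B, F.obj, B', Z, G.obj]
    have := Diagram.box w (♯0 ⊠ ♯1) (♯3 ⊠ ♯4) k
    have := Diagram.box w (♯4 ⊠ ♯2) (♯5 ⊠ ♯6) F.hom
    have := Diagram.box w (♯3 ⊠ ♯5) (♯7 ⊠ ♯8) l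
    have := Diagram.box w (♯6) (♯9) φ.hom
    exact Diagram.eq w (♯0 ⊠ ♯1 ⊠ ♯2) (.cons _ (.cons _ (.swap _ _ _)))
  · rw [h]
    let w : List C := [A', Z, F.obj, X, A, B, G.obj, B', Z, G.obj]
    have := Diagram.box w (♯0 ⊠ ♯1) (♯3 ⊠ ♯4) k
    have := Diagram.box w (♯4 ⊠ ♯9) (♯5 ⊠ ♯6) G.hom
    have := Diagram.box w (♯3 ⊠ ♯5) (♯7 ⊠ ♯8) l
    have := Diagram.box w (♯2) (♯9) φ.hom
    exact Diagram.eq w (♯0 ⊠ ♯1 ⊠ ♯2) (.swap _ _ _)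

theorem trace_ctx {F : FormalTrace A B} {t : A ⟶ B} (ht : t ∈ F.trace)
    (k : A' ⊗ Z ⟶ X ⊗ A) (l : X ⊗ B ⟶ B' ⊗ Z) : (F.ctx k l).trace = tr Z (k ≫ X ◁ t ≫ l) := by
  have inner := mem_tr_comp (mem_tr_whiskerLeft ht X) k l
  simp only [Category.assoc] at inner
  rw [trace, ctx, ← vanishing_tensor _ (Part.dom_iff_mem.2 ⟨_, inner⟩), Part.eq_some_iff.2 inner,
    Part.bind_some]

theorem Equiv.of_mem {F G : FormalTrace A B} {t : A ⟶ B} (hF : t ∈ F.trace) (hG : t ∈ G.trace) :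
    F.Equiv G :=
  fun _ _ _ _ k l => by rw [trace_ctx hF, trace_ctx hG]

theorem ctx_ctx {A'' B'' X' Z' : C} (k : A' ⊗ Z ⟶ X ⊗ A) (l : X ⊗ B ⟶ B' ⊗ Z)
    (k' : A'' ⊗ Z' ⟶ X' ⊗ A') (l' : X' ⊗ B' ⟶ B'' ⊗ Z') (F : FormalTrace A B) :
    ((F.ctx k l).ctx k' l').Equiv
      (F.ctx (Z := Z' ⊗ Z) (X := X' ⊗ X)
        ((α_ _ _ _).inv ≫ k' ▷ Z ≫ (α_ _ _ _).hom ≫ X' ◁ k ≫ (α_ _ _ _).inv)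
        ((α_ _ _ _).hom ≫ X' ◁ l ≫ (α_ _ _ _).inv ≫ l' ▷ Z ≫ (α_ _ _ _).hom)) := by
  refine .of_conj (α_ Z' Z F.obj).symm ?_
  dsimp only [ctx, Iso.symm_hom]
  let w : List C := [A'', Z', Z, F.obj, X', A', X, A, B, F.obj, B', Z, B'', Z']
  have := Diagram.box w (♯0 ⊠ ♯1) (♯4 ⊠ ♯5) k'
  have := Diagram.box w (♯5 ⊠ ♯2) (♯6 ⊠ ♯7) k
  have := Diagram.box w (♯7 ⊠ ♯3) (♯8 ⊠ ♯9) F.hom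
  have := Diagram.box w (♯6 ⊠ ♯8) (♯10 ⊠ ♯11) l
  have := Diagram.box w (♯4 ⊠ ♯10) (♯12 ⊠ ♯13) l'
  exact Diagram.eq w (♯0 ⊠ ♯1 ⊠ ♯2 ⊠ ♯3)

theorem trace_ctx_unit (F : FormalTrace A B) :
    (F.ctx ((ρ_ A).hom ≫ (λ_ A).inv) ((λ_ B).hom ≫ (ρ_ B).inv)).trace = F.trace := by
  refine trace_eq_of_conj (λ_ F.obj) ?_
  dsimp only [ctx]
  let w : List C := [A, F.obj, B, F.obj]
  have := Diagram.box w (♯0 ⊠ ♯1) (♯2 ⊠ ♯3) F.hom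
  exact Diagram.eq w (♯0 ⊠ .one ⊠ ♯1)

theorem Equiv.trace_eq {F G : FormalTrace A B} (h : F.Equiv G) : F.trace = G.trace := by
  rw [← trace_ctx_unit F, ← trace_ctx_unit G, h]

theorem Equiv.mem_tr {U : C} {f : A ⊗ U ⟶ B ⊗ U} {G : FormalTrace A B}
    (h : (FormalTrace.mk U f).Equiv G) {t : A ⟶ B} (ht : t ∈ G.trace) : t ∈ tr U f :=
  h.trace_eq.ge _ ht

theorem Equiv.ctx {F G : FormalTrace A B} (h : F.Equiv G) (k : A' ⊗ Z ⟶ X ⊗ A)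
    (l : X ⊗ B ⟶ B' ⊗ Z) : (F.ctx k l).Equiv (G.ctx k l) :=
  fun _ _ _ _ k' l' => by rw [(ctx_ctx k l k' l' F).trace_eq, (ctx_ctx k l k' l' G).trace_eq, h]

theorem ctx_equiv_ctx {Z' X' : C} {k : A' ⊗ Z ⟶ X ⊗ A} {l : X ⊗ B ⟶ B' ⊗ Z}
    {k' : A' ⊗ Z' ⟶ X' ⊗ A} {l' : X' ⊗ B ⟶ B' ⊗ Z'} (φ : Z ≅ Z') (ξ : X ≅ X')
    (hk : k ≫ ξ.hom ▷ A = A' ◁ φ.hom ≫ k') (hl : l ≫ B' ◁ φ.hom = ξ.hom ▷ B ≫ l')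
    (F : FormalTrace A B) : (F.ctx k l).Equiv (F.ctx k' l') := by
  refine .of_conj (whiskerRightIso φ F.obj) ?_
  dsimp only [FormalTrace.ctx, whiskerRightIso_hom]
  calc
    _ = (α_ _ _ _).inv ≫ (k ▷ F.obj ≫ (α_ _ _ _).hom ≫ X ◁ F.hom ≫ (α_ _ _ _).inv ≫
        (l ≫ B' ◁ φ.hom) ▷ F.obj) ≫ (α_ _ _ _).hom := by simp
    _ = (α_ _ _ _).inv ≫ ((k ≫ ξ.hom ▷ A) ▷ F.obj ≫ (α_ _ _ _).hom ≫ X' ◁ F.hom ≫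
        (α_ _ _ _).inv ≫ l' ▷ F.obj) ≫ (α_ _ _ _).hom := by
      rw [hl]
      let w : List C := [A', Z, F.obj, X, A, B, F.obj, X', B', Z']
      have := Diagram.box w (♯0 ⊠ ♯1) (♯3 ⊠ ♯4) k
      have := Diagram.box w (♯4 ⊠ ♯2) (♯5 ⊠ ♯6) F.hom
      have := Diagram.box w (♯3) (♯7) ξ.hom
      have := Diagram.box w (♯7 ⊠ ♯5) (♯8 ⊠ ♯9) l'
      exact Diagram.eq w (♯0 ⊠ ♯1 ⊠ ♯2) (.cons _ (.swap _ _ _))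
    _ = _ := by
      rw [hk]
      simp

theorem wrap_equiv_ctx (k : A' ⟶ X ⊗ A) (l : X ⊗ B ⟶ B') (F : FormalTrace A B) :
    (F.wrap k l).Equiv (F.ctx ((ρ_ A').hom ≫ k) (l ≫ (ρ_ B').inv)) := by
  refine .symm (.of_conj (λ_ F.obj) ?_)
  dsimp only [FormalTrace.ctx, wrap]
  let w : List C := [A', F.obj, X, A, B, F.obj, B']
  have := Diagram.box w (♯0) (♯2 ⊠ ♯3) k
  have := Diagram.box w (♯3 ⊠ ♯1) (♯4 ⊠ ♯5) F.hom
  have := Diagram.box w (♯2 ⊠ ♯4) (♯6) l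
  exact Diagram.eq w (♯0 ⊠ .one ⊠ ♯1)

theorem Equiv.wrap {F G : FormalTrace A B} (h : F.Equiv G) (k : A' ⟶ X ⊗ A) (l : X ⊗ B ⟶ B') :
    (F.wrap k l).Equiv (G.wrap k l) :=
  (wrap_equiv_ctx k l F).trans ((h.ctx _ _).trans (wrap_equiv_ctx k l G).symm)

theorem mem_trace_wrap {F : FormalTrace A B} {t : A ⟶ B} (ht : t ∈ F.trace) (k : A' ⟶ X ⊗ A)
    (l : X ⊗ B ⟶ B') : k ≫ X ◁ t ≫ l ∈ (F.wrap k l).trace := by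
  simpa only [trace, wrap, Category.assoc] using mem_tr_comp (mem_tr_whiskerLeft ht X) k l

theorem Equiv.of_mem_tr {U V : C} {f : (A ⊗ U) ⊗ V ⟶ (B ⊗ U) ⊗ V} {t : A ⊗ U ⟶ B ⊗ U}
    (ht : t ∈ tr V f) :
    Equiv ⟨U ⊗ V, (α_ A U V).inv ≫ f ≫ (α_ B U V).hom⟩ ⟨U, t⟩ := by
  intro A' B' Z X k l
  have inner := trace_ctx (F := ⟨V, f⟩) ht ((α_ A' Z U).inv ≫ k ▷ U ≫ (α_ _ _ _).hom)
    ((α_ _ _ _).inv ≫ l ▷ U ≫ (α_ B' Z U).hom)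
  have outer : (FormalTrace.ctx k l ⟨U, t⟩).trace = tr (Z ⊗ U)
      (((α_ A' Z U).inv ≫ k ▷ U ≫ (α_ _ _ _).hom) ≫ X ◁ t ≫
        (α_ _ _ _).inv ≫ l ▷ U ≫ (α_ B' Z U).hom) := by
    simp only [trace, FormalTrace.ctx, Category.assoc]
  rw [outer, ← inner]
  refine trace_eq_of_conj (α_ Z U V).symm ?_
  dsimp only [FormalTrace.ctx, Iso.symm_hom]
  let w : List C := [A', Z, U, V, X, A, B, U, V, B', Z]
  have := Diagram.box w (♯0 ⊠ ♯1) (♯4 ⊠ ♯5) k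
  have := Diagram.box w ((♯5 ⊠ ♯2) ⊠ ♯3) ((♯6 ⊠ ♯7) ⊠ ♯8) f
  have := Diagram.box w (♯4 ⊠ ♯6) (♯9 ⊠ ♯10) l
  exact Diagram.eq w (♯0 ⊠ ♯1 ⊠ ♯2 ⊠ ♯3)

theorem Equiv.of_yanking {F G : FormalTrace A B} {V Y : C} (φ : F.obj ≅ G.obj ⊗ V)
    (e : A ⊗ G.obj ≅ Y ⊗ V)
    (h : F.hom ≫ B ◁ φ.hom = A ◁ φ.hom ≫ (α_ _ _ _).inv ≫ (e.hom ▷ V ≫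
      ((α_ Y V V).hom ≫ Y ◁ (β_ V V).hom ≫ (α_ Y V V).inv) ≫ (e.inv ≫ G.hom) ▷ V) ≫
      (α_ _ _ _).hom) : F.Equiv G :=
  (Equiv.of_conj (G := ⟨G.obj ⊗ V, _⟩) φ h).trans
    (.of_mem_tr (mem_tr_of_yanking _ _ (e.hom_inv_id_assoc _).symm rfl))

end FormalTrace

/-! ### Evaluation of paths -/

namespace IntP

open PartialTrace

/-- A morphism on the positive wires and one on the negative wires. The arrow `Split.hom` formed by
them composes with every arrow, since the traced wires are then straightened by yanking. -/
@[ext]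
structure Split (A B : IntP C) where
  pos : A.pos ⟶ B.pos
  neg : B.neg ⟶ A.neg

/-- The arrow that acts separately on the positive and on the negative wires. -/
def Split.hom {A B : IntP C} (s : Split A B) : A ⟶ B := Hom.mk (s.pos ⊗ₘ s.neg)

/-- The identity morphisms on the positive and on the negative wires. -/
def Split.id (A : IntP C) : Split A A := ⟨𝟙 A.pos, 𝟙 A.neg⟩

theorem Split.hom_id (A : IntP C) : (Split.id A).hom = idHom A :=
  congrArg Hom.mk (id_tensorHom_id A.pos A.neg)

/-- The composite of the arrow of `s` with `g`. -/
def preSplit {A B D : IntP C} (s : Split A B) (g : B ⟶ D) : A ⟶ D :=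
  Hom.mk (s.pos ▷ D.neg ≫ g.hom ≫ D.pos ◁ s.neg)

/-- The composite of `f` with the arrow of `s`. -/
def postSplit {A B D : IntP C} (f : A ⟶ B) (s : Split B D) : A ⟶ D :=
  Hom.mk (A.pos ◁ s.neg ≫ f.hom ≫ s.pos ▷ A.neg)

namespace Split

/-- Split arrows compose on both kinds of wires. -/
def comp {A B D : IntP C} (s : Split A B) (t : Split B D) : Split A D :=
  ⟨s.pos ≫ t.pos, t.neg ≫ s.neg⟩

/-- The tensor product of split arrows. -/
def tensor {A A' B B' : IntP C} (s : Split A A') (t : Split B B') :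
    Split (tensorObj A B) (tensorObj A' B') :=
  ⟨s.pos ⊗ₘ t.pos, t.neg ⊗ₘ s.neg⟩

/-- The split arrow `1_X ⊗ s`. -/
def left (X : IntP C) {A B : IntP C} (s : Split A B) : Split (tensorObj X A) (tensorObj X B) :=
  ⟨X.pos ◁ s.pos, s.neg ▷ X.neg⟩

/-- The split arrow `s ⊗ 1_X`. -/
def right {A B : IntP C} (s : Split A B) (X : IntP C) : Split (tensorObj A X) (tensorObj B X) :=
  ⟨s.pos ▷ X.pos, X.neg ◁ s.neg⟩

/-- The associator `(A ⊗ B) ⊗ D ⟶ A ⊗ (B ⊗ D)`. -/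
def assoc (A B D : IntP C) : Split (tensorObj (tensorObj A B) D) (tensorObj A (tensorObj B D)) :=
  ⟨(α_ A.pos B.pos D.pos).hom, (α_ D.neg B.neg A.neg).hom⟩

/-- The inverse of the associator. -/
def assocInv (A B D : IntP C) :
    Split (tensorObj A (tensorObj B D)) (tensorObj (tensorObj A B) D) :=
  ⟨(α_ A.pos B.pos D.pos).inv, (α_ D.neg B.neg A.neg).inv⟩

/-- The left unitor `I ⊗ A ⟶ A`. -/
def leftUnit (A : IntP C) : Split (tensorObj (unit C) A) A := ⟨(λ_ A.pos).hom, (ρ_ A.neg).inv⟩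

/-- The inverse of the left unitor. -/
def leftUnitInv (A : IntP C) : Split A (tensorObj (unit C) A) := ⟨(λ_ A.pos).inv, (ρ_ A.neg).hom⟩

/-- The right unitor `A ⊗ I ⟶ A`. -/
def rightUnit (A : IntP C) : Split (tensorObj A (unit C)) A := ⟨(ρ_ A.pos).hom, (λ_ A.neg).inv⟩

/-- The inverse of the right unitor. -/
def rightUnitInv (A : IntP C) : Split A (tensorObj A (unit C)) := ⟨(ρ_ A.pos).inv, (λ_ A.neg).hom⟩

end Split

section WirePermutations

variable [SymmetricCategory C]

/-- The formal trace whose value is the partial composite of a path. -/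
def pathTrace {A B : IntP C} (p : Quiver.Path A B) :
    FormalTrace (A.pos ⊗ B.neg) (B.pos ⊗ A.neg) where
  obj := feedback p
  hom := 𝟙 ((A.pos ⊗ B.neg) ⊗ feedback p) ⊗≫ A.pos ◁ (β_ B.neg (feedback p)).hom ⊗≫
    precomp p ⊗≫ 𝟙 ((B.pos ⊗ A.neg) ⊗ feedback p)

/-- The permutation of the input wires in the composition with an arrow on the right. -/
def rightIn (A B D : IntP C) : (A.pos ⊗ D.neg) ⊗ B.neg ⟶ D.neg ⊗ (A.pos ⊗ B.neg) :=
  (α_ _ _ _).hom ≫ A.pos ◁ (β_ D.neg B.neg).hom ≫ (α_ _ _ _).inv ≫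
    (β_ (A.pos ⊗ B.neg) D.neg).hom

/-- The application of an arrow on the right to the output wires. -/
def rightOut (A : IntP C) {B D : IntP C} (g : B ⟶ D) :
    D.neg ⊗ (B.pos ⊗ A.neg) ⟶ (D.pos ⊗ A.neg) ⊗ B.neg :=
  (α_ _ _ _).inv ≫ (β_ D.neg B.pos).hom ▷ A.neg ≫ g.hom ▷ A.neg ≫ (α_ _ _ _).hom ≫
    D.pos ◁ (β_ B.neg A.neg).hom ≫ (α_ _ _ _).inv

/-- The application of an arrow on the left to the input wires. -/
def leftIn {A B : IntP C} (g : A ⟶ B) (D : IntP C) :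
    (A.pos ⊗ D.neg) ⊗ B.neg ⟶ A.neg ⊗ (B.pos ⊗ D.neg) :=
  (α_ _ _ _).hom ≫ A.pos ◁ (β_ D.neg B.neg).hom ≫ (α_ _ _ _).inv ≫ g.hom ▷ D.neg ≫
    (β_ B.pos A.neg).hom ▷ D.neg ≫ (α_ _ _ _).hom

/-- The permutation of the output wires in the composition with an arrow on the left. -/
def leftOut (A B D : IntP C) : A.neg ⊗ (D.pos ⊗ B.neg) ⟶ (D.pos ⊗ A.neg) ⊗ B.neg :=
  (α_ _ _ _).inv ≫ (β_ A.neg D.pos).hom ▷ B.neg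

/-- Composition of a formal trace with an arrow on the right. -/
def actRight {A B D : IntP C} (F : FormalTrace (A.pos ⊗ B.neg) (B.pos ⊗ A.neg)) (g : B ⟶ D) :
    FormalTrace (A.pos ⊗ D.neg) (D.pos ⊗ A.neg) :=
  F.ctx (rightIn A B D) (rightOut A g)

/-- Composition of a formal trace with an arrow on the left. -/
def actLeft {A B D : IntP C} (g : A ⟶ B) (F : FormalTrace (B.pos ⊗ D.neg) (D.pos ⊗ B.neg)) :
    FormalTrace (A.pos ⊗ D.neg) (D.pos ⊗ A.neg) :=
  F.ctx (leftIn g D) (leftOut A B D)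

theorem pathTrace_hom {A B : IntP C} (p : Quiver.Path A B) :
    (pathTrace p).hom = (α_ _ _ _).hom ≫ A.pos ◁ (β_ B.neg (feedback p)).hom ≫ precomp p ≫
      (α_ _ _ _).inv := by
  simp [pathTrace, monoidalComp]

theorem pathTrace_cons_hom {A B D : IntP C} (p : Quiver.Path A B) (g : B ⟶ D) :
    (pathTrace (p.cons g)).hom ≫ (D.pos ⊗ A.neg) ◁ (β_ (feedback p) B.neg).hom =
      (A.pos ⊗ D.neg) ◁ (β_ (feedback p) B.neg).hom ≫ (actRight (pathTrace p) g).hom := by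
  dsimp only [actRight, FormalTrace.ctx]
  rw [pathTrace_hom, pathTrace_hom]
  dsimp only [precomp, rightIn, rightOut, feedback, pathTrace]
  let w : List C := [A.pos, D.neg, feedback p, B.neg, B.pos, A.neg, feedback p, D.pos, B.neg]
  have := Diagram.box w (♯0 ⊠ ♯2 ⊠ ♯3) (♯4 ⊠ ♯5 ⊠ ♯6) (precomp p)
  have := Diagram.box w (♯4 ⊠ ♯1) (♯7 ⊠ ♯8) g.hom
  exact Diagram.eq w ((♯0 ⊠ ♯1) ⊠ (♯2 ⊠ ♯3))

/-- The permutation of the input wires in `1_X ⊗ F`. -/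
def tensorLeftIn (X A B : IntP C) :
    (X.pos ⊗ A.pos) ⊗ (B.neg ⊗ X.neg) ⟶ (X.pos ⊗ X.neg) ⊗ (A.pos ⊗ B.neg) :=
  (α_ _ _ _).hom ≫ X.pos ◁ (α_ _ _ _).inv ≫ X.pos ◁ (β_ _ _).hom ≫ (α_ _ _ _).inv

/-- The permutation of the output wires in `1_X ⊗ F`. -/
def tensorLeftOut (X A B : IntP C) :
    (X.pos ⊗ X.neg) ⊗ (B.pos ⊗ A.neg) ⟶ (X.pos ⊗ B.pos) ⊗ (A.neg ⊗ X.neg) :=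
  (α_ _ _ _).hom ≫ X.pos ◁ (β_ _ _).hom ≫ X.pos ◁ (α_ _ _ _).hom ≫ (α_ _ _ _).inv

/-- The permutation of the input wires in `F ⊗ 1_X`. -/
def tensorRightIn (X A B : IntP C) :
    (A.pos ⊗ X.pos) ⊗ (X.neg ⊗ B.neg) ⟶ (X.pos ⊗ X.neg) ⊗ (A.pos ⊗ B.neg) :=
  (α_ _ _ _).hom ≫ A.pos ◁ (α_ _ _ _).inv ≫ (α_ _ _ _).inv ≫ (β_ _ _).hom ▷ B.neg ≫
    (α_ _ _ _).hom

/-- The permutation of the output wires in `F ⊗ 1_X`. -/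
def tensorRightOut (X A B : IntP C) :
    (X.pos ⊗ X.neg) ⊗ (B.pos ⊗ A.neg) ⟶ (B.pos ⊗ X.pos) ⊗ (X.neg ⊗ A.neg) :=
  (α_ _ _ _).inv ≫ (β_ _ _).hom ▷ A.neg ≫ (α_ _ _ _).hom ≫ B.pos ◁ (α_ _ _ _).hom ≫ (α_ _ _ _).inv

theorem tensorHom_id_left (X : IntP C) {A B : IntP C} (f : A ⟶ B) :
    (tensorHom (idHom X) f).hom =
      tensorLeftIn X A B ≫ (X.pos ⊗ X.neg) ◁ f.hom ≫ tensorLeftOut X A B := by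
  dsimp only [tensorHom, idHom, tensorLeftIn, tensorLeftOut, tensorObj]
  let w : List C := [X.pos, A.pos, B.neg, X.neg, B.pos, A.neg]
  have := Diagram.box w (♯1 ⊠ ♯2) (♯4 ⊠ ♯5) f.hom
  exact Diagram.eq w ((♯0 ⊠ ♯1) ⊠ (♯2 ⊠ ♯3))

theorem tensorHom_id_right (X : IntP C) {A B : IntP C} (f : A ⟶ B) :
    (tensorHom f (idHom X)).hom =
      tensorRightIn X A B ≫ (X.pos ⊗ X.neg) ◁ f.hom ≫ tensorRightOut X A B := by
  dsimp only [tensorHom, idHom, tensorRightIn, tensorRightOut, tensorObj]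
  let w : List C := [A.pos, X.pos, X.neg, B.neg, B.pos, A.neg]
  have := Diagram.box w (♯0 ⊠ ♯3) (♯4 ⊠ ♯5) f.hom
  exact Diagram.eq w ((♯0 ⊠ ♯1) ⊠ (♯2 ⊠ ♯3))

theorem tensorHom_id_id (A B : IntP C) : tensorHom (idHom A) (idHom B) = idHom (tensorObj A B) := by
  refine congrArg Hom.mk ?_
  dsimp only [idHom, tensorObj]
  exact Diagram.eq [A.pos, B.pos, B.neg, A.neg] ((♯0 ⊠ ♯1) ⊠ ♯2 ⊠ ♯3)

namespace Split

/-- The symmetry `A ⊗ B ⟶ B ⊗ A`. -/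
def braid (A B : IntP C) : Split (tensorObj A B) (tensorObj B A) :=
  ⟨(β_ A.pos B.pos).hom, (β_ A.neg B.neg).hom⟩

theorem tensorHom_hom {A A' B B' : IntP C} (s : Split A A') (t : Split B B') :
    tensorHom s.hom t.hom = (s.tensor t).hom := by
  refine congrArg Hom.mk ?_
  dsimp only [hom, tensor, tensorObj]
  let w : List C := [A.pos, B.pos, B'.neg, A'.neg, A'.pos, A.neg, B'.pos, B.neg]
  have := Diagram.box w (♯0) (♯4) s.pos
  have := Diagram.box w (♯3) (♯5) s.neg
  have := Diagram.box w (♯1) (♯6) t.pos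
  have := Diagram.box w (♯2) (♯7) t.neg
  exact Diagram.eq w ((♯0 ⊠ ♯1) ⊠ (♯2 ⊠ ♯3))
    (.trans (.cons _ (.swap _ _ _)) (.cons _ (.cons _ (.swap _ _ _))))

theorem tensorHom_idHom_hom (X : IntP C) {A B : IntP C} (s : Split A B) :
    tensorHom (idHom X) s.hom = (s.left X).hom := by
  rw [← hom_id, tensorHom_hom, tensor, left, Split.id, id_tensorHom, tensorHom_id]

theorem tensorHom_hom_idHom {A B : IntP C} (s : Split A B) (X : IntP C) :
    tensorHom s.hom (idHom X) = (s.right X).hom := by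
  rw [← hom_id, tensorHom_hom, tensor, right, Split.id, id_tensorHom, tensorHom_id]

end Split

end WirePermutations

variable [SymmetricCategory C] [PartialTrace C]

theorem comp_eq_trace {A B : IntP C} (p : Quiver.Path A B) :
    comp p = (pathTrace p).trace.map Hom.mk := rfl

theorem mem_comp_iff {A B : IntP C} {p : Quiver.Path A B} {f : A ⟶ B} :
    f ∈ comp p ↔ f.hom ∈ (pathTrace p).trace := by
  rw [comp_eq_trace, Part.mem_map_iff]
  exact ⟨fun ⟨_, ht, htf⟩ => htf ▸ ht, fun h => ⟨_, h, rfl⟩⟩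

theorem pathTrace_cons {A B D : IntP C} (p : Quiver.Path A B) (g : B ⟶ D) :
    (pathTrace (p.cons g)).Equiv (actRight (pathTrace p) g) :=
  .of_conj (β_ (feedback p) B.neg) (pathTrace_cons_hom p g)

theorem id_mem_pathTrace_nil (A : IntP C) :
    𝟙 (A.pos ⊗ A.neg) ∈ (pathTrace (Quiver.Path.nil : Quiver.Path A A)).trace := by
  refine Part.eq_some_iff.1
    ((vanishing_unit (pathTrace (.nil : Quiver.Path A A)).hom).trans (congrArg Part.some ?_))
  change (ρ_ (A.pos ⊗ A.neg)).inv ≫ (𝟙 ((A.pos ⊗ A.neg) ⊗ 𝟙_ C) ⊗≫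
    A.pos ◁ (β_ A.neg (𝟙_ C)).hom ⊗≫ A.pos ◁ ((λ_ A.neg).hom ≫ (ρ_ A.neg).inv) ⊗≫
    𝟙 ((A.pos ⊗ A.neg) ⊗ 𝟙_ C)) ≫ (ρ_ _).hom = _
  exact Diagram.eq [A.pos, A.neg] (♯0 ⊠ ♯1)

theorem actRight_actLeft {A B D E : IntP C} (g : A ⟶ B)
    (F : FormalTrace (B.pos ⊗ D.neg) (D.pos ⊗ B.neg)) (h : D ⟶ E) :
    (actRight (actLeft g F) h).Equiv (actLeft g (actRight F h)) := by
  refine (FormalTrace.ctx_ctx _ _ _ _ F).trans (.trans ?_ (FormalTrace.ctx_ctx _ _ _ _ F).symm)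
  refine FormalTrace.ctx_equiv_ctx (β_ D.neg B.neg) (β_ E.neg A.neg) ?_ ?_ F
  · dsimp only [rightIn, leftIn]
    let w : List C := [A.pos, E.neg, D.neg, B.neg, B.pos, A.neg]
    have := Diagram.box w (♯0 ⊠ ♯3) (♯4 ⊠ ♯5) g.hom
    exact Diagram.eq w ((♯0 ⊠ ♯1) ⊠ (♯2 ⊠ ♯3))
  · dsimp only [rightOut, leftOut]
    let w : List C := [E.neg, A.neg, D.pos, B.neg, E.pos, D.neg]
    have := Diagram.box w (♯2 ⊠ ♯0) (♯4 ⊠ ♯5) h.hom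
    exact Diagram.eq w ((♯0 ⊠ ♯1) ⊠ (♯2 ⊠ ♯3))

/-- `h` is the composite of `f` and `g`. -/
def IsComp {A B D : IntP C} (f : A ⟶ B) (g : B ⟶ D) (h : A ⟶ D) : Prop :=
  h.hom ∈ tr B.neg (rightIn A B D ≫ D.neg ◁ f.hom ≫ rightOut A g)

theorem isComp_postSplit {A B D : IntP C} (f : A ⟶ B) (s : Split B D) :
    IsComp f s.hom (postSplit f s) := by
  refine mem_tr_of_yanking (A.pos ◁ s.neg) (f.hom ≫ s.pos ▷ A.neg) rfl ?_
  dsimp only [Split.hom, rightIn, rightOut]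
  let w : List C := [A.pos, D.neg, B.neg, B.neg, B.pos, A.neg, D.pos]
  have := Diagram.box w (♯1) (♯3) s.neg
  have := Diagram.box w (♯0 ⊠ ♯2) (♯4 ⊠ ♯5) f.hom
  have := Diagram.box w (♯4) (♯6) s.pos
  exact Diagram.eq w ((♯0 ⊠ ♯1) ⊠ ♯2) (.trans (.cons _ (.swap _ _ _)) (.swap _ _ _))

theorem isComp_preSplit {A B D : IntP C} (s : Split A B) (g : B ⟶ D) :
    IsComp s.hom g (preSplit s g) := by
  refine mem_tr_of_yanking (s.pos ▷ D.neg ≫ g.hom) (D.pos ◁ s.neg) (Category.assoc _ _ _).symm ?_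
  dsimp only [Split.hom, rightIn, rightOut]
  let w : List C := [A.pos, D.neg, B.neg, B.pos, A.neg, D.pos, B.neg]
  have := Diagram.box w (♯0) (♯3) s.pos
  have := Diagram.box w (♯2) (♯4) s.neg
  have := Diagram.box w (♯3 ⊠ ♯1) (♯5 ⊠ ♯6) g.hom
  exact Diagram.eq w ((♯0 ⊠ ♯1) ⊠ ♯2) (.cons _ (.swap _ _ _))

theorem id_isComp {A B : IntP C} (f : A ⟶ B) : IsComp (idHom A) f f := by
  have h := isComp_preSplit (Split.id A) f
  rw [Split.hom_id] at h
  simpa only [preSplit, Split.id, id_whiskerRight, whiskerLeft_id, Category.id_comp,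
    Category.comp_id] using! h

theorem mem_trace_actRight_iff {A B D : IntP C} {F : FormalTrace (A.pos ⊗ B.neg) (B.pos ⊗ A.neg)}
    {f : A ⟶ B} (hf : f.hom ∈ F.trace) (g : B ⟶ D) {h : A ⟶ D} :
    h.hom ∈ (actRight F g).trace ↔ IsComp f g h := by
  rw [actRight, FormalTrace.trace_ctx hf, IsComp]

theorem mem_pathTrace_toPath {A B : IntP C} (f : A ⟶ B) : f.hom ∈ (pathTrace f.toPath).trace := by
  have h := (mem_trace_actRight_iff (f := idHom A) (id_mem_pathTrace_nil A) f).2 (id_isComp f)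
  rwa [← (pathTrace_cons _ f).trace_eq] at h

theorem mem_comp_pair_iff {A B D : IntP C} {f : A ⟶ B} {g : B ⟶ D} {h : A ⟶ D} :
    h ∈ comp (f.toPath.cons g) ↔ IsComp f g h := by
  rw [mem_comp_iff, (pathTrace_cons _ g).trace_eq,
    mem_trace_actRight_iff (mem_pathTrace_toPath f)]

theorem mem_trace_actLeft_nil {A B : IntP C} (f : A ⟶ B) :
    f.hom ∈ (actLeft f (pathTrace (Quiver.Path.nil : Quiver.Path B B))).trace := by
  rw [actLeft, FormalTrace.trace_ctx (id_mem_pathTrace_nil B)]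
  refine mem_tr_of_yanking (𝟙 (A.pos ⊗ B.neg)) f.hom (Category.id_comp _).symm ?_
  dsimp only [leftIn, leftOut]
  let w : List C := [A.pos, B.neg, B.neg, B.pos, A.neg]
  have := Diagram.box w (♯0 ⊠ ♯2) (♯3 ⊠ ♯4) f.hom
  exact Diagram.eq w ((♯0 ⊠ ♯1) ⊠ ♯2)

theorem pathTrace_toPath_comp {A B D : IntP C} (f : A ⟶ B) (p : Quiver.Path B D) :
    (pathTrace (f.toPath.comp p)).Equiv (actLeft f (pathTrace p)) := by
  induction p with
  | nil => exact .of_mem (mem_pathTrace_toPath f) (mem_trace_actLeft_nil f)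
  | cons p g ih =>
    exact (pathTrace_cons _ g).trans ((ih.ctx _ _).trans
      ((actRight_actLeft f (pathTrace p) g).trans ((pathTrace_cons p g).symm.ctx _ _)))

theorem pathTrace_comp_right {A B D : IntP C} {p p' : Quiver.Path A B}
    (h : (pathTrace p).Equiv (pathTrace p')) (q : Quiver.Path B D) :
    (pathTrace (p.comp q)).Equiv (pathTrace (p'.comp q)) := by
  induction q with
  | nil => exact h
  | cons q g ih => exact (pathTrace_cons _ g).trans ((ih.ctx _ _).trans (pathTrace_cons _ g).symm)

theorem pathTrace_comp_left {A B D : IntP C} (p : Quiver.Path A B) {q q' : Quiver.Path B D}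
    (h : (pathTrace q).Equiv (pathTrace q')) :
    (pathTrace (p.comp q)).Equiv (pathTrace (p.comp q')) := by
  induction p with
  | nil => simpa only [Quiver.Path.nil_comp] using h
  | cons p g ih =>
    simpa only [← Quiver.Path.comp_assoc] using! ih ((pathTrace_toPath_comp g q).trans
      ((h.ctx _ _).trans (pathTrace_toPath_comp g q').symm))

theorem actRight_tensorLeft (X : IntP C) {A B D : IntP C}
    (F : FormalTrace (A.pos ⊗ B.neg) (B.pos ⊗ A.neg)) (g : B ⟶ D) :
    (actRight (A := tensorObj X A) (B := tensorObj X B) (D := tensorObj X D)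
        (F.wrap (tensorLeftIn X A B) (tensorLeftOut X A B)) (tensorHom (idHom X) g)).Equiv
      ((actRight F g).wrap (tensorLeftIn X A D) (tensorLeftOut X A D)) := by
  refine .of_yanking (V := X.neg) (Y := ((X.pos ⊗ A.pos) ⊗ D.neg) ⊗ (B.neg ⊗ F.obj))
    (α_ B.neg X.neg F.obj ≪≫ whiskerLeftIso B.neg (β_ X.neg F.obj) ≪≫ (α_ B.neg F.obj X.neg).symm)
    (whiskerRightIso (α_ (X.pos ⊗ A.pos) D.neg X.neg).symm (B.neg ⊗ F.obj) ≪≫ α_ _ _ _ ≪≫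
      whiskerLeftIso _ (β_ X.neg (B.neg ⊗ F.obj)) ≪≫ (α_ _ _ _).symm) ?_
  dsimp only [actRight, FormalTrace.ctx, FormalTrace.wrap, rightOut]
  rw [tensorHom_id_left]
  dsimp only [rightIn, tensorLeftIn, tensorLeftOut, tensorObj, Iso.trans_hom, Iso.trans_inv,
    Iso.symm_hom, Iso.symm_inv, whiskerLeftIso, whiskerRightIso]
  let w : List C :=
    [X.pos, A.pos, D.neg, X.neg, B.neg, X.neg, F.obj, B.pos, A.neg, F.obj, D.pos, B.neg]
  have := Diagram.box w ((♯1 ⊠ ♯4) ⊠ ♯6) ((♯7 ⊠ ♯8) ⊠ ♯9) F.hom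
  have := Diagram.box w (♯7 ⊠ ♯2) (♯10 ⊠ ♯11) g.hom
  exact Diagram.eq w (((♯0 ⊠ ♯1) ⊠ ♯2 ⊠ ♯3) ⊠ ((♯4 ⊠ ♯5) ⊠ ♯6))

theorem actRight_tensorRight (X : IntP C) {A B D : IntP C}
    (F : FormalTrace (A.pos ⊗ B.neg) (B.pos ⊗ A.neg)) (g : B ⟶ D) :
    (actRight (A := tensorObj A X) (B := tensorObj B X) (D := tensorObj D X)
        (F.wrap (tensorRightIn X A B) (tensorRightOut X A B)) (tensorHom g (idHom X))).Equiv
      ((actRight F g).wrap (tensorRightIn X A D) (tensorRightOut X A D)) := by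
  refine .of_yanking (V := X.neg) (Y := ((A.pos ⊗ X.pos) ⊗ D.neg) ⊗ (B.neg ⊗ F.obj))
    (α_ X.neg B.neg F.obj ≪≫ β_ X.neg (B.neg ⊗ F.obj))
    (whiskerRightIso (whiskerLeftIso _ (β_ _ _) ≪≫ (α_ (A.pos ⊗ X.pos) D.neg X.neg).symm)
      (B.neg ⊗ F.obj) ≪≫ α_ _ _ _ ≪≫
      whiskerLeftIso _ (β_ X.neg (B.neg ⊗ F.obj)) ≪≫ (α_ _ _ _).symm) ?_
  dsimp only [actRight, FormalTrace.ctx, FormalTrace.wrap, rightOut]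
  rw [tensorHom_id_right]
  dsimp only [rightIn, tensorRightIn, tensorRightOut, tensorObj, Iso.trans_hom, Iso.trans_inv,
    Iso.symm_hom, Iso.symm_inv, whiskerLeftIso, whiskerRightIso]
  let w : List C :=
    [A.pos, X.pos, X.neg, D.neg, X.neg, B.neg, F.obj, B.pos, A.neg, F.obj, D.pos, B.neg]
  have := Diagram.box w ((♯0 ⊠ ♯5) ⊠ ♯6) ((♯7 ⊠ ♯8) ⊠ ♯9) F.hom
  have := Diagram.box w (♯7 ⊠ ♯3) (♯10 ⊠ ♯11) g.hom
  exact Diagram.eq w (((♯0 ⊠ ♯1) ⊠ ♯2 ⊠ ♯3) ⊠ ((♯4 ⊠ ♯5) ⊠ ♯6))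

theorem pathTrace_tensorLeft (X : IntP C) {A B : IntP C} (p : Quiver.Path A B) :
    (pathTrace ((tensorLeft X).mapPath p)).Equiv
      ((pathTrace p).wrap (tensorLeftIn X A B) (tensorLeftOut X A B)) := by
  induction p with
  | nil =>
    refine .of_mem (id_mem_pathTrace_nil (tensorObj X A)) ?_
    change (idHom (tensorObj X A)).hom ∈ _
    rw [← tensorHom_id_id, tensorHom_id_left]
    exact FormalTrace.mem_trace_wrap (id_mem_pathTrace_nil A) _ _
  | cons p g ih =>
    exact (pathTrace_cons _ _).trans ((ih.ctx _ _).trans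
      ((actRight_tensorLeft X _ g).trans ((pathTrace_cons p g).symm.wrap _ _)))

theorem pathTrace_tensorRight (X : IntP C) {A B : IntP C} (p : Quiver.Path A B) :
    (pathTrace ((tensorRight X).mapPath p)).Equiv
      ((pathTrace p).wrap (tensorRightIn X A B) (tensorRightOut X A B)) := by
  induction p with
  | nil =>
    refine .of_mem (id_mem_pathTrace_nil (tensorObj A X)) ?_
    change (idHom (tensorObj A X)).hom ∈ _
    rw [← tensorHom_id_id, tensorHom_id_right]
    exact FormalTrace.mem_trace_wrap (id_mem_pathTrace_nil A) _ _
  | cons p g ih =>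
    exact (pathTrace_cons _ _).trans ((ih.ctx _ _).trans
      ((actRight_tensorRight X _ g).trans ((pathTrace_cons p g).symm.wrap _ _)))

theorem isCongruence_pathTrace :
    IsCongruence fun (_ _ : IntP C) p q => (pathTrace p).Equiv (pathTrace q) where
  equivalence _ _ := ⟨fun _ => .refl _, .symm, .trans⟩
  comp h h' := (pathTrace_comp_right h _).trans (pathTrace_comp_left _ h')
  eval _ f h := .of_mem (mem_comp_iff.1 h) (mem_pathTrace_toPath f)
  tensorRight X h := (pathTrace_tensorRight X _).trans
    ((h.wrap _ _).trans (pathTrace_tensorRight X _).symm)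
  tensorLeft X h := (pathTrace_tensorLeft X _).trans
    ((h.wrap _ _).trans (pathTrace_tensorLeft X _).symm)

theorem comp_eq_of_sim {A B : IntP C} {p q : Quiver.Path A B} (h : sim C p q) :
    comp p = comp q := by
  rw [comp_eq_trace, comp_eq_trace, (h _ isCongruence_pathTrace).trace_eq]

theorem isCongruence_sim : IsCongruence fun (A B : IntP C) p q => sim C (X := A) (Y := B) p q where
  equivalence A B :=
    ⟨fun p _ hS => (hS.equivalence A B).refl p, fun h _ hS => (hS.equivalence A B).symm (h _ hS),
      fun h h' _ hS => (hS.equivalence A B).trans (h _ hS) (h' _ hS)⟩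
  comp h h' _ hS := hS.comp (h _ hS) (h' _ hS)
  eval p f h _ hS := hS.eval p f h
  tensorRight X h _ hS := hS.tensorRight X (h _ hS)
  tensorLeft X h _ hS := hS.tensorLeft X (h _ hS)

theorem mem_comp_iff_sim {A B : IntP C} {p : Quiver.Path A B} {f : A ⟶ B} :
    f ∈ comp p ↔ sim C (X := A) (Y := B) p f.toPath :=
  ⟨isCongruence_sim.eval p f, fun h => by
    rw [comp_eq_of_sim h, mem_comp_iff]
    exact mem_pathTrace_toPath f⟩

end IntP

/-! ### The canonical trace of a compact closed category -/

section CanonicalTrace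

variable {D : Type u} [Category.{v} D] [MonoidalCategory D] [SymmetricCategory D]

/-- The canonical trace along `U`, computed with an arbitrary dual `X` of `U`. -/
def loopTrace (X U : D) [ExactPairing X U] {A B : D} (f : A ⊗ U ⟶ B ⊗ U) : A ⟶ B :=
  (ρ_ A).inv ≫ A ◁ η_ X U ≫ A ◁ (β_ X U).hom ≫ (α_ A U X).inv ≫ f ▷ X ≫ (α_ B U X).hom ≫
    B ◁ ε_ X U ≫ (ρ_ B).hom

theorem loopTrace_dinaturality {X U X' U' : D} [ExactPairing X U] [ExactPairing X' U'] {A B : D}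
    (f : A ⊗ U ⟶ B ⊗ U') (g : U' ⟶ U) :
    loopTrace X U (f ≫ B ◁ g) = loopTrace X' U' (A ◁ g ≫ f) := by
  let _ : HasLeftDual U := ⟨X⟩
  let _ : HasLeftDual U' := ⟨X'⟩
  have slide_cup : η_ X U ≫ (ᘁg) ▷ U = η_ X' U' ≫ X' ◁ g := coevaluation_comp_leftAdjointMate g
  have slide_cap : U' ◁ (ᘁg) ≫ ε_ X' U' = g ▷ X ≫ ε_ X U := leftAdjointMate_comp_evaluation g
  calc loopTrace X U (f ≫ B ◁ g)
    _ = (ρ_ A).inv ≫ A ◁ η_ X U ≫ A ◁ (β_ X U).hom ≫ (α_ A U X).inv ≫ f ▷ X ≫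
        (α_ B U' X).hom ≫ B ◁ (g ▷ X ≫ ε_ X U) ≫ (ρ_ B).hom := by simp [loopTrace]
    _ = (ρ_ A).inv ≫ A ◁ (η_ X U ≫ (ᘁg) ▷ U) ≫ A ◁ (β_ X' U).hom ≫ (α_ A U X').inv ≫ f ▷ X' ≫
        (α_ B U' X').hom ≫ B ◁ ε_ X' U' ≫ (ρ_ B).hom := by
      rw [← slide_cap]
      let w : List D := [A, X, U, B, U', X']
      have := Diagram.box w .one (♯1 ⊠ ♯2) (η_ X U)
      have := Diagram.box w (♯0 ⊠ ♯2) (♯3 ⊠ ♯4) f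
      have : Diagram w (♯1) _ (♯5) (ᘁg) := Diagram.box w (♯1) (♯5) (X := X) (Y := X') (ᘁg)
      have := Diagram.box w (♯4 ⊠ ♯5) .one (ε_ X' U')
      exact Diagram.eq w (♯0) (.cons _ (.swap _ _ _))
    _ = loopTrace X' U' (A ◁ g ≫ f) := by
      rw [slide_cup, loopTrace]
      let w : List D := [A, X', U', U, B, U']
      have := Diagram.box w .one (♯1 ⊠ ♯2) (η_ X' U')
      have := Diagram.box w (♯2) (♯3) g
      have := Diagram.box w (♯0 ⊠ ♯3) (♯4 ⊠ ♯5) f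
      have := Diagram.box w (♯5 ⊠ ♯1) .one (ε_ X' U')
      exact Diagram.eq w (♯0)

theorem loopTrace_eq (X X' : D) {U : D} [ExactPairing X U] [ExactPairing X' U] {A B : D}
    (f : A ⊗ U ⟶ B ⊗ U) : loopTrace X U f = loopTrace X' U f := by
  simpa using loopTrace_dinaturality (X := X) (X' := X') f (𝟙 U)

theorem loopTrace_unit {A B : D} (f : A ⊗ 𝟙_ D ⟶ B ⊗ 𝟙_ D) :
    loopTrace (𝟙_ D) (𝟙_ D) f = (ρ_ A).inv ≫ f ≫ (ρ_ B).hom := by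
  change (ρ_ A).inv ≫ A ◁ (ρ_ (𝟙_ D)).inv ≫ A ◁ (β_ (𝟙_ D) (𝟙_ D)).hom ≫ (α_ _ _ _).inv ≫
    f ▷ 𝟙_ D ≫ (α_ _ _ _).hom ≫ B ◁ (ρ_ (𝟙_ D)).hom ≫ (ρ_ B).hom = _
  let w : List D := [A, B]
  have := Diagram.box w (♯0 ⊠ .one) (♯1 ⊠ .one) f
  exact Diagram.eq w (♯0)

theorem loopTrace_tensor {X U Y V : D} [ExactPairing X U] [ExactPairing Y V] {A B : D}
    (f : (A ⊗ U) ⊗ V ⟶ (B ⊗ U) ⊗ V) :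
    loopTrace X U (loopTrace Y V f) =
      loopTrace (Y ⊗ X) (U ⊗ V) ((α_ A U V).inv ≫ f ≫ (α_ B U V).hom) := by
  change _ = (ρ_ A).inv ≫ A ◁ (η_ Y V ⊗≫ (Y ◁ η_ X U) ▷ V ⊗≫ 𝟙 ((Y ⊗ X) ⊗ (U ⊗ V))) ≫
    A ◁ (β_ (Y ⊗ X) (U ⊗ V)).hom ≫ (α_ _ _ _).inv ≫
    ((α_ A U V).inv ≫ f ≫ (α_ B U V).hom) ▷ (Y ⊗ X) ≫ (α_ _ _ _).hom ≫
    B ◁ (𝟙 ((U ⊗ V) ⊗ (Y ⊗ X)) ⊗≫ U ◁ (ε_ Y V ▷ X) ⊗≫ ε_ X U) ≫ (ρ_ B).hom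
  dsimp only [loopTrace]
  let w : List D := [A, X, U, Y, V, B, U, V]
  have := Diagram.box w .one (♯1 ⊠ ♯2) (η_ X U)
  have := Diagram.box w (♯6 ⊠ ♯1) .one (ε_ X U)
  have := Diagram.box w .one (♯3 ⊠ ♯4) (η_ Y V)
  have := Diagram.box w (♯7 ⊠ ♯3) .one (ε_ Y V)
  have := Diagram.box w ((♯0 ⊠ ♯2) ⊠ ♯4) ((♯5 ⊠ ♯6) ⊠ ♯7) f
  exact Diagram.eq w (♯0) (.swap _ _ _)

theorem loopTrace_naturality {X U : D} [ExactPairing X U] {A B A' B' : D} (f : A ⊗ U ⟶ B ⊗ U)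
    (g : A' ⟶ A) (h : B ⟶ B') :
    g ≫ loopTrace X U f ≫ h = loopTrace X U (g ▷ U ≫ f ≫ h ▷ U) := by
  dsimp only [loopTrace]
  let w : List D := [A', A, X, U, B, U, B']
  have := Diagram.box w .one (♯2 ⊠ ♯3) (η_ X U)
  have := Diagram.box w (♯5 ⊠ ♯2) .one (ε_ X U)
  have := Diagram.box w (♯1 ⊠ ♯3) (♯4 ⊠ ♯5) f
  have := Diagram.box w (♯0) (♯1) g
  have := Diagram.box w (♯4) (♯6) h
  exact Diagram.eq w (♯0) (.trans (.swap _ _ _) (.cons _ (.cons _ (.cons _ (.swap _ _ _)))))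

theorem loopTrace_strength {X U : D} [ExactPairing X U] {A B Y Z : D} (f : A ⊗ U ⟶ B ⊗ U)
    (g : Y ⟶ Z) :
    g ⊗ₘ loopTrace X U f = loopTrace X U ((α_ Y A U).hom ≫ (g ⊗ₘ f) ≫ (α_ Z B U).inv) := by
  dsimp only [loopTrace]
  let w : List D := [Y, A, X, U, B, U, Z]
  have := Diagram.box w .one (♯2 ⊠ ♯3) (η_ X U)
  have := Diagram.box w (♯5 ⊠ ♯2) .one (ε_ X U)
  have := Diagram.box w (♯1 ⊠ ♯3) (♯4 ⊠ ♯5) f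
  have := Diagram.box w (♯0) (♯6) g
  exact Diagram.eq w (♯0 ⊠ ♯1) (.swap _ _ _)

theorem loopTrace_yanking (X A : D) [ExactPairing X A] : loopTrace X A (β_ A A).hom = 𝟙 A := by
  calc loopTrace X A (β_ A A).hom
    _ = (ρ_ A).inv ≫ (A ◁ η_ X A ≫ (α_ A X A).inv ≫ ε_ X A ▷ A) ≫ (λ_ A).hom := by
      dsimp only [loopTrace]
      let w : List D := [A, X, A]
      have := Diagram.box w .one (♯1 ⊠ ♯2) (η_ X A)
      have := Diagram.box w (♯0 ⊠ ♯1) .one (ε_ X A)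
      exact Diagram.eq w (♯0)
    _ = 𝟙 A := by simp

/-- The canonical trace of a compact closed category, as a total trace. -/
def canonicalTotalTrace [LeftRigidCategory D] : TotalTrace D where
  tr U f := canonicalTrace U f
  naturality := loopTrace_naturality
  dinaturality := loopTrace_dinaturality
  strength := loopTrace_strength
  vanishing_unit f := (loopTrace_eq _ (𝟙_ D) f).trans (loopTrace_unit f)
  vanishing_tensor f := (loopTrace_tensor f).trans (loopTrace_eq _ _ _)
  yanking A := loopTrace_yanking _ A

end CanonicalTrace

/-! ### The category of paths modulo `∼` -/

namespace IntP

open PartialTrace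

variable [SymmetricCategory C] [PartialTrace C]

instance : Congruence (sim C) where
  equivalence := isCongruence_sim.equivalence _ _
  comp_left _ _ _ h := isCongruence_sim.comp ((isCongruence_sim.equivalence _ _).refl _) h
  comp_right _ h := isCongruence_sim.comp h ((isCongruence_sim.equivalence _ _).refl _)

/-- An object of `Int^p(C)`, as an object of the completion. -/
def of (A : IntP C) : Completion C := (toCompletion C).obj A

/-- The class of a path in the completion. -/
def ofPath {A B : IntP C} (p : Quiver.Path A B) : of A ⟶ of B :=
  (CategoryTheory.Quotient.functor (sim C)).map (X := A) (Y := B) p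

/-- The class of an arrow in the completion. -/
def ofHom {A B : IntP C} (f : A ⟶ B) : of A ⟶ of B := (toCompletion C).map f

theorem ofPath_eq_iff {A B : IntP C} {p q : Quiver.Path A B} :
    ofPath p = ofPath q ↔ sim C (X := A) (Y := B) p q :=
  CategoryTheory.Quotient.functor_map_eq_iff (sim C) (X := A) (Y := B) p q

theorem mem_comp_iff_ofPath {A B : IntP C} {p : Quiver.Path A B} {f : A ⟶ B} :
    f ∈ comp p ↔ ofPath p = ofHom f :=
  mem_comp_iff_sim.trans ofPath_eq_iff.symm

theorem ofHom_injective {A B : IntP C} {f g : A ⟶ B} (h : ofHom f = ofHom g) : f = g :=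
  Part.mem_unique (o := comp f.toPath) (mem_comp_iff_ofPath.2 rfl) (mem_comp_iff_ofPath.2 h)

theorem ofHom_idHom (A : IntP C) : ofHom (idHom A) = 𝟙 (of A) :=
  (mem_comp_iff_ofPath.1 (mem_comp_iff.2 (id_mem_pathTrace_nil A))).symm

theorem ofHom_comp_ofHom_eq_iff {A B D : IntP C} {f : A ⟶ B} {g : B ⟶ D} {h : A ⟶ D} :
    ofHom f ≫ ofHom g = ofHom h ↔ IsComp f g h :=
  mem_comp_iff_ofPath.symm.trans mem_comp_pair_iff

theorem hom_induction {P : ∀ {A B : IntP C}, (of A ⟶ of B) → Prop}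
    (id : ∀ A : IntP C, P (𝟙 (of A)))
    (comp : ∀ {A B D : IntP C} (p : of A ⟶ of B) (f : B ⟶ D), P p → P (p ≫ ofHom f))
    {A B : IntP C} (f : of A ⟶ of B) : P f := by
  obtain ⟨p, rfl⟩ : ∃ p : Quiver.Path A B, ofPath p = f := ⟨Quot.out f, Quot.out_eq f⟩
  induction p with
  | nil => exact id A
  | cons p g ih => exact comp (ofPath p) g ih

theorem naturality_of_ofHom {L R : Completion C ⥤ Completion C}
    (c : ∀ A : IntP C, L.obj (of A) ⟶ R.obj (of A))
    (h : ∀ {A B : IntP C} (f : A ⟶ B), L.map (ofHom f) ≫ c B = c A ≫ R.map (ofHom f))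
    {A B : IntP C} (f : of A ⟶ of B) : L.map f ≫ c B = c A ≫ R.map f := by
  induction f using hom_induction with
  | id A => simp
  | comp p f ih =>
    rw [L.map_comp, R.map_comp, Category.assoc, h, ← Category.assoc, ih, Category.assoc]

/-! ### Split arrows in the completion -/

/-- The class in the completion of the arrow of `s`. -/
def ofSplit {A B : IntP C} (s : Split A B) : of A ⟶ of B := ofHom s.hom

theorem ofHom_comp_ofSplit {A B D : IntP C} (f : A ⟶ B) (s : Split B D) :
    ofHom f ≫ ofSplit s = ofHom (postSplit f s) :=
  ofHom_comp_ofHom_eq_iff.2 (isComp_postSplit f s)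

theorem ofSplit_comp_ofHom {A B D : IntP C} (s : Split A B) (g : B ⟶ D) :
    ofSplit s ≫ ofHom g = ofHom (preSplit s g) :=
  ofHom_comp_ofHom_eq_iff.2 (isComp_preSplit s g)

theorem ofHom_comp_ofSplit_eq {A B B' D : IntP C} {f : A ⟶ B} {s : Split B D} {s' : Split A B'}
    {g : B' ⟶ D} (h : postSplit f s = preSplit s' g) :
    ofHom f ≫ ofSplit s = ofSplit s' ≫ ofHom g := by
  rw [ofHom_comp_ofSplit, ofSplit_comp_ofHom, h]

theorem ofSplit_id (A : IntP C) : ofSplit (.id A) = 𝟙 (of A) := by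
  rw [ofSplit, Split.hom_id, ofHom_idHom]

theorem ofSplit_comp {A B D : IntP C} (s : Split A B) (t : Split B D) :
    ofSplit s ≫ ofSplit t = ofSplit (s.comp t) := by
  refine (ofHom_comp_ofSplit s.hom t).trans (congrArg (fun k => ofHom (Hom.mk k)) ?_)
  simp only [Split.hom, Split.comp, ← id_tensorHom, ← tensorHom_id, tensorHom_comp_tensorHom,
    Category.id_comp, Category.comp_id]

/-- The isomorphism of the completion that acts separately on the positive and on the negative
wires. -/
def splitIso {A B : IntP C} (a : A.pos ≅ B.pos) (b : B.neg ≅ A.neg) : of A ≅ of B where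
  hom := ofSplit ⟨a.hom, b.hom⟩
  inv := ofSplit ⟨a.inv, b.inv⟩
  hom_inv_id := by
    rw [ofSplit_comp, Split.comp, a.hom_inv_id, b.inv_hom_id]
    exact ofSplit_id A
  inv_hom_id := by
    rw [ofSplit_comp, Split.comp, a.inv_hom_id, b.hom_inv_id]
    exact ofSplit_id B

/-! ### The tensor product of the completion -/

/-- The functor `X ⊗ -` on the completion. -/
def leftFunctor (X : IntP C) : Completion C ⥤ Completion C :=
  CategoryTheory.Quotient.lift (sim C)
    (Cat.freeMap (tensorLeft X) ⋙ CategoryTheory.Quotient.functor (sim C))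
    fun _ _ _ _ h => ofPath_eq_iff.2 (isCongruence_sim.tensorLeft X h)

/-- The functor `- ⊗ X` on the completion. -/
def rightFunctor (X : IntP C) : Completion C ⥤ Completion C :=
  CategoryTheory.Quotient.lift (sim C)
    (Cat.freeMap (tensorRight X) ⋙ CategoryTheory.Quotient.functor (sim C))
    fun _ _ _ _ h => ofPath_eq_iff.2 (isCongruence_sim.tensorRight X h)

/-- The tensor product of an object with a morphism, between objects of `Int^p(C)`. -/
def homLeft (X : IntP C) {A B : IntP C} (f : of A ⟶ of B) :
    of (tensorObj X A) ⟶ of (tensorObj X B) := (leftFunctor X).map f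

/-- The tensor product of a morphism with an object, between objects of `Int^p(C)`. -/
def homRight {A B : IntP C} (f : of A ⟶ of B) (X : IntP C) :
    of (tensorObj A X) ⟶ of (tensorObj B X) := (rightFunctor X).map f

theorem homLeft_comp (X : IntP C) {A B D : IntP C} (f : of A ⟶ of B) (g : of B ⟶ of D) :
    homLeft X (f ≫ g) = homLeft X f ≫ homLeft X g := (leftFunctor X).map_comp f g

theorem homRight_comp {A B D : IntP C} (f : of A ⟶ of B) (g : of B ⟶ of D) (X : IntP C) :
    homRight (f ≫ g) X = homRight f X ≫ homRight g X := (rightFunctor X).map_comp f g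

theorem homLeft_id (X A : IntP C) : homLeft X (𝟙 (of A)) = 𝟙 _ := (leftFunctor X).map_id _

theorem homRight_id (A X : IntP C) : homRight (𝟙 (of A)) X = 𝟙 _ := (rightFunctor X).map_id _

theorem homLeft_ofSplit (X : IntP C) {A B : IntP C} (s : Split A B) :
    homLeft X (ofSplit s) = ofSplit (s.left X) :=
  congrArg ofHom (s.tensorHom_idHom_hom X)

theorem homRight_ofSplit {A B : IntP C} (s : Split A B) (X : IntP C) :
    homRight (ofSplit s) X = ofSplit (s.right X) :=
  congrArg ofHom (s.tensorHom_hom_idHom X)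

theorem tensorHom_isComp_right_left {A A' B B' : IntP C} (f : A ⟶ A') (g : B ⟶ B') :
    IsComp (tensorHom f (idHom B)) (tensorHom (idHom A') g) (tensorHom f g) := by
  refine mem_tr_of_yanking (X := A.pos ⊗ B'.pos) (U := B.neg ⊗ A'.neg)
    ((α_ _ _ _).hom ≫ A.pos ◁ ((α_ _ _ _).inv ≫ g.hom ▷ A'.neg ≫ (α_ _ _ _).hom) ≫ (α_ _ _ _).inv)
    ((α_ _ _ _).hom ≫ A.pos ◁ (B'.pos ◁ (β_ _ _).hom ≫ (α_ _ _ _).inv ≫ (β_ _ _).hom ▷ B.neg ≫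
      (α_ _ _ _).hom) ≫ (α_ _ _ _).inv ≫ f.hom ▷ (B'.pos ⊗ B.neg) ≫ (α_ _ _ _).hom ≫
      A'.pos ◁ (β_ _ _).hom ≫ A'.pos ◁ (α_ _ _ _).hom ≫ (α_ _ _ _).inv) ?_ ?_
  · dsimp only [tensorHom, tensorObj]
    let w : List C := [A.pos, B.pos, B'.neg, A'.neg, A'.pos, A.neg, B'.pos, B.neg]
    have := Diagram.box w (♯0 ⊠ ♯3) (♯4 ⊠ ♯5) f.hom
    have := Diagram.box w (♯1 ⊠ ♯2) (♯6 ⊠ ♯7) g.hom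
    exact Diagram.eq w ((♯0 ⊠ ♯1) ⊠ (♯2 ⊠ ♯3)) (.swap _ _ _)
  · dsimp only [rightOut]
    rw [tensorHom_id_left, tensorHom_id_right]
    dsimp only [rightIn, tensorLeftIn, tensorLeftOut, tensorRightIn, tensorRightOut, tensorObj]
    let w : List C := [A.pos, B.pos, B'.neg, A'.neg, B.neg, A'.neg, A'.pos, A.neg, B'.pos, B.neg]
    have := Diagram.box w (♯0 ⊠ ♯5) (♯6 ⊠ ♯7) f.hom
    have := Diagram.box w (♯1 ⊠ ♯2) (♯8 ⊠ ♯9) g.hom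
    exact Diagram.eq w (((♯0 ⊠ ♯1) ⊠ (♯2 ⊠ ♯3)) ⊠ (♯4 ⊠ ♯5)) (.swap _ _ _)

theorem tensorHom_isComp_left_right {A A' B B' : IntP C} (f : A ⟶ A') (g : B ⟶ B') :
    IsComp (tensorHom (idHom A) g) (tensorHom f (idHom B')) (tensorHom f g) := by
  refine mem_tr_of_yanking (X := A'.pos ⊗ B.pos) (U := B'.neg ⊗ A.neg)
    ((α_ _ _ _).hom ≫ A.pos ◁ ((α_ _ _ _).inv ≫ (β_ _ _).hom) ≫ (α_ _ _ _).inv ≫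
      f.hom ▷ (B.pos ⊗ B'.neg) ≫ (α_ _ _ _).hom ≫ A'.pos ◁ (β_ _ _).hom ≫
      A'.pos ◁ (α_ _ _ _).hom ≫ (α_ _ _ _).inv)
    ((α_ _ _ _).hom ≫ A'.pos ◁ ((α_ _ _ _).inv ≫ g.hom ▷ A.neg ≫ (α_ _ _ _).hom) ≫ (α_ _ _ _).inv)
    ?_ ?_
  · dsimp only [tensorHom, tensorObj]
    let w : List C := [A.pos, B.pos, B'.neg, A'.neg, A'.pos, A.neg, B'.pos, B.neg]
    have := Diagram.box w (♯0 ⊠ ♯3) (♯4 ⊠ ♯5) f.hom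
    have := Diagram.box w (♯1 ⊠ ♯2) (♯6 ⊠ ♯7) g.hom
    exact Diagram.eq w ((♯0 ⊠ ♯1) ⊠ (♯2 ⊠ ♯3))
  · dsimp only [rightOut]
    rw [tensorHom_id_left, tensorHom_id_right]
    dsimp only [rightIn, tensorLeftIn, tensorLeftOut, tensorRightIn, tensorRightOut, tensorObj]
    let w : List C := [A.pos, B.pos, B'.neg, A'.neg, B'.neg, A.neg, A'.pos, A.neg, B'.pos, B.neg]
    have := Diagram.box w (♯0 ⊠ ♯3) (♯6 ⊠ ♯7) f.hom
    have := Diagram.box w (♯1 ⊠ ♯4) (♯8 ⊠ ♯9) g.hom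
    exact Diagram.eq w (((♯0 ⊠ ♯1) ⊠ (♯2 ⊠ ♯3)) ⊠ (♯4 ⊠ ♯5)) (.swap _ _ _)

theorem homRight_comp_homLeft {A A' B B' : IntP C} (f : of A ⟶ of A') (g : of B ⟶ of B') :
    homRight f B ≫ homLeft A' g = homLeft A g ≫ homRight f B' :=
  naturality_of_ofHom (L := rightFunctor B) (R := rightFunctor B') (fun A => homLeft A g)
    (fun {A A'} f => (naturality_of_ofHom (L := leftFunctor A) (R := leftFunctor A')
      (fun B => ofHom (tensorHom f (idHom B)))
      (fun g => (ofHom_comp_ofHom_eq_iff.2 (tensorHom_isComp_left_right f g)).trans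
        (ofHom_comp_ofHom_eq_iff.2 (tensorHom_isComp_right_left f g)).symm) g).symm) f

/-! ### Naturality of the structural arrows -/

theorem assoc_naturality_left {A A' : IntP C} (f : A ⟶ A') (B D : IntP C) :
    ofHom (tensorHom (tensorHom f (idHom B)) (idHom D)) ≫ ofSplit (.assoc A' B D) =
      ofSplit (.assoc A B D) ≫ ofHom (tensorHom f (idHom (tensorObj B D))) := by
  refine ofHom_comp_ofSplit_eq (congrArg Hom.mk ?_)
  rw [tensorHom_id_right, tensorHom_id_right, tensorHom_id_right]
  dsimp only [Split.assoc, tensorRightIn, tensorRightOut, tensorObj]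
  let w : List C := [A.pos, B.pos, D.pos, D.neg, B.neg, A'.neg, A'.pos, A.neg]
  have := Diagram.box w (♯0 ⊠ ♯5) (♯6 ⊠ ♯7) f.hom
  exact Diagram.eq w (((♯0 ⊠ ♯1) ⊠ ♯2) ⊠ ((♯3 ⊠ ♯4) ⊠ ♯5))

theorem assoc_naturality_middle (A : IntP C) {B B' : IntP C} (f : B ⟶ B') (D : IntP C) :
    ofHom (tensorHom (tensorHom (idHom A) f) (idHom D)) ≫ ofSplit (.assoc A B' D) =
      ofSplit (.assoc A B D) ≫ ofHom (tensorHom (idHom A) (tensorHom f (idHom D))) := by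
  refine ofHom_comp_ofSplit_eq (congrArg Hom.mk ?_)
  rw [tensorHom_id_right, tensorHom_id_left, tensorHom_id_left, tensorHom_id_right]
  dsimp only [Split.assoc, tensorRightIn, tensorRightOut, tensorLeftIn, tensorLeftOut, tensorObj]
  let w : List C := [A.pos, B.pos, D.pos, D.neg, B'.neg, A.neg, B'.pos, B.neg]
  have := Diagram.box w (♯1 ⊠ ♯4) (♯6 ⊠ ♯7) f.hom
  exact Diagram.eq w (((♯0 ⊠ ♯1) ⊠ ♯2) ⊠ ((♯3 ⊠ ♯4) ⊠ ♯5))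

theorem assoc_naturality_right (A B : IntP C) {D D' : IntP C} (f : D ⟶ D') :
    ofHom (tensorHom (idHom (tensorObj A B)) f) ≫ ofSplit (.assoc A B D') =
      ofSplit (.assoc A B D) ≫ ofHom (tensorHom (idHom A) (tensorHom (idHom B) f)) := by
  refine ofHom_comp_ofSplit_eq (congrArg Hom.mk ?_)
  rw [tensorHom_id_left, tensorHom_id_left, tensorHom_id_left]
  dsimp only [Split.assoc, tensorLeftIn, tensorLeftOut, tensorObj]
  let w : List C := [A.pos, B.pos, D.pos, D'.neg, B.neg, A.neg, D'.pos, D.neg]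
  have := Diagram.box w (♯2 ⊠ ♯3) (♯6 ⊠ ♯7) f.hom
  exact Diagram.eq w (((♯0 ⊠ ♯1) ⊠ ♯2) ⊠ ((♯3 ⊠ ♯4) ⊠ ♯5))

theorem leftUnit_naturality {A B : IntP C} (f : A ⟶ B) :
    ofHom (tensorHom (idHom (unit C)) f) ≫ ofSplit (.leftUnit B) =
      ofSplit (.leftUnit A) ≫ ofHom f := by
  refine ofHom_comp_ofSplit_eq (congrArg Hom.mk ?_)
  rw [tensorHom_id_left]
  dsimp only [Split.leftUnit, tensorLeftIn, tensorLeftOut, tensorObj, unit]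
  let w : List C := [A.pos, B.neg, B.pos, A.neg]
  have := Diagram.box w (♯0 ⊠ ♯1) (♯2 ⊠ ♯3) f.hom
  exact Diagram.eq w ((.one ⊠ ♯0) ⊠ ♯1)

theorem rightUnit_naturality {A B : IntP C} (f : A ⟶ B) :
    ofHom (tensorHom f (idHom (unit C))) ≫ ofSplit (.rightUnit B) =
      ofSplit (.rightUnit A) ≫ ofHom f := by
  refine ofHom_comp_ofSplit_eq (congrArg Hom.mk ?_)
  rw [tensorHom_id_right]
  dsimp only [Split.rightUnit, tensorRightIn, tensorRightOut, tensorObj, unit]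
  let w : List C := [A.pos, B.neg, B.pos, A.neg]
  have := Diagram.box w (♯0 ⊠ ♯1) (♯2 ⊠ ♯3) f.hom
  exact Diagram.eq w ((♯0 ⊠ .one) ⊠ ♯1)

theorem braid_naturality_left {A A' : IntP C} (f : A ⟶ A') (B : IntP C) :
    ofHom (tensorHom f (idHom B)) ≫ ofSplit (.braid A' B) =
      ofSplit (.braid A B) ≫ ofHom (tensorHom (idHom B) f) := by
  refine ofHom_comp_ofSplit_eq (congrArg Hom.mk ?_)
  rw [tensorHom_id_left, tensorHom_id_right]
  dsimp only [Split.braid, tensorRightIn, tensorRightOut, tensorLeftIn, tensorLeftOut, tensorObj]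
  let w : List C := [A.pos, B.pos, A'.neg, B.neg, A'.pos, A.neg]
  have := Diagram.box w (♯0 ⊠ ♯2) (♯4 ⊠ ♯5) f.hom
  exact Diagram.eq w ((♯0 ⊠ ♯1) ⊠ (♯2 ⊠ ♯3))

theorem braid_naturality_right (A : IntP C) {B B' : IntP C} (f : B ⟶ B') :
    ofHom (tensorHom (idHom A) f) ≫ ofSplit (.braid A B') =
      ofSplit (.braid A B) ≫ ofHom (tensorHom f (idHom A)) := by
  refine ofHom_comp_ofSplit_eq (congrArg Hom.mk ?_)
  rw [tensorHom_id_left, tensorHom_id_right]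
  dsimp only [Split.braid, tensorRightIn, tensorRightOut, tensorLeftIn, tensorLeftOut, tensorObj]
  let w : List C := [A.pos, B.pos, A.neg, B'.neg, B'.pos, B.neg]
  have := Diagram.box w (♯1 ⊠ ♯3) (♯4 ⊠ ♯5) f.hom
  exact Diagram.eq w ((♯0 ⊠ ♯1) ⊠ (♯2 ⊠ ♯3))

theorem homRight_homRight {A A' : IntP C} (f : of A ⟶ of A') (B D : IntP C) :
    homRight (homRight f B) D ≫ ofSplit (.assoc A' B D) =
      ofSplit (.assoc A B D) ≫ homRight f (tensorObj B D) :=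
  naturality_of_ofHom (L := rightFunctor B ⋙ rightFunctor D) (R := rightFunctor (tensorObj B D))
    (fun A => ofSplit (.assoc A B D)) (fun f => assoc_naturality_left f B D) f

theorem homRight_homLeft (A : IntP C) {B B' : IntP C} (f : of B ⟶ of B') (D : IntP C) :
    homRight (homLeft A f) D ≫ ofSplit (.assoc A B' D) =
      ofSplit (.assoc A B D) ≫ homLeft A (homRight f D) :=
  naturality_of_ofHom (L := leftFunctor A ⋙ rightFunctor D) (R := rightFunctor D ⋙ leftFunctor A)
    (fun B => ofSplit (.assoc A B D)) (fun f => assoc_naturality_middle A f D) f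

theorem homLeft_tensorObj (A B : IntP C) {D D' : IntP C} (f : of D ⟶ of D') :
    homLeft (tensorObj A B) f ≫ ofSplit (.assoc A B D') =
      ofSplit (.assoc A B D) ≫ homLeft A (homLeft B f) :=
  naturality_of_ofHom (L := leftFunctor (tensorObj A B)) (R := leftFunctor B ⋙ leftFunctor A)
    (fun D => ofSplit (.assoc A B D)) (fun f => assoc_naturality_right A B f) f

theorem homLeft_unit {A B : IntP C} (f : of A ⟶ of B) :
    homLeft (unit C) f ≫ ofSplit (.leftUnit B) = ofSplit (.leftUnit A) ≫ f :=
  naturality_of_ofHom (L := leftFunctor (unit C)) (R := 𝟭 _)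
    (fun A => ofSplit (.leftUnit A)) leftUnit_naturality f

theorem homRight_unit {A B : IntP C} (f : of A ⟶ of B) :
    homRight f (unit C) ≫ ofSplit (.rightUnit B) = ofSplit (.rightUnit A) ≫ f :=
  naturality_of_ofHom (L := rightFunctor (unit C)) (R := 𝟭 _)
    (fun A => ofSplit (.rightUnit A)) rightUnit_naturality f

theorem homRight_braid {A A' : IntP C} (f : of A ⟶ of A') (B : IntP C) :
    homRight f B ≫ ofSplit (.braid A' B) = ofSplit (.braid A B) ≫ homLeft B f :=
  naturality_of_ofHom (L := rightFunctor B) (R := leftFunctor B)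
    (fun A => ofSplit (.braid A B)) (fun f => braid_naturality_left f B) f

theorem homLeft_braid (A : IntP C) {B B' : IntP C} (f : of B ⟶ of B') :
    homLeft A f ≫ ofSplit (.braid A B') = ofSplit (.braid A B) ≫ homRight f A :=
  naturality_of_ofHom (L := leftFunctor A) (R := rightFunctor A)
    (fun B => ofSplit (.braid A B)) (fun f => braid_naturality_right A f) f

/-! ### The compact closed structure of the completion -/

theorem tensorHom_interchange {A B D A' B' D' : IntP C} (f : of A ⟶ of B) (f' : of A' ⟶ of B')
    (g : of B ⟶ of D) (g' : of B' ⟶ of D') :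
    (homRight f A' ≫ homLeft B f') ≫ homRight g B' ≫ homLeft D g' =
      homRight (f ≫ g) A' ≫ homLeft D (f' ≫ g') := by
  rw [homRight_comp, homLeft_comp, Category.assoc, Category.assoc, ← Category.assoc (homLeft B f'),
    ← homRight_comp_homLeft, Category.assoc]

theorem tensorHom_assoc {A B D A' B' D' : IntP C} (f : of A ⟶ of A') (g : of B ⟶ of B')
    (h : of D ⟶ of D') :
    (homRight (homRight f B ≫ homLeft A' g) D ≫ homLeft (tensorObj A' B') h) ≫
        ofSplit (.assoc A' B' D') =
      ofSplit (.assoc A B D) ≫ homRight f (tensorObj B D) ≫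
        homLeft A' (homRight g D ≫ homLeft B' h) := by
  rw [homRight_comp, Category.assoc, homLeft_tensorObj, Category.assoc,
    ← Category.assoc (homRight (homLeft A' g) D), homRight_homLeft, ← Category.assoc,
    ← Category.assoc, ← Category.assoc, homRight_homRight, homLeft_comp]
  simp only [Category.assoc]

theorem ofSplit_pentagon (A B D E : IntP C) :
    homRight (ofSplit (.assoc A B D)) E ≫ ofSplit (.assoc A (tensorObj B D) E) ≫
        homLeft A (ofSplit (.assoc B D E)) =
      ofSplit (.assoc (tensorObj A B) D E) ≫ ofSplit (.assoc A B (tensorObj D E)) := by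
  simp only [homLeft_ofSplit, homRight_ofSplit, ofSplit_comp]
  refine congrArg ofSplit (Split.ext ?_ ?_)
  · exact pentagon _ _ _ _
  · dsimp only [Split.comp, Split.left, Split.right, Split.assoc, tensorObj]
    exact Diagram.eq [E.neg, D.neg, B.neg, A.neg] (((♯0 ⊠ ♯1) ⊠ ♯2) ⊠ ♯3)

theorem ofSplit_triangle (A B : IntP C) :
    ofSplit (.assoc A (unit C) B) ≫ homLeft A (ofSplit (.leftUnit B)) =
      homRight (ofSplit (.rightUnit A)) B := by
  simp only [homLeft_ofSplit, homRight_ofSplit, ofSplit_comp]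
  refine congrArg ofSplit (Split.ext ?_ ?_)
  · exact triangle _ _
  · dsimp only [Split.comp, Split.left, Split.right, Split.assoc, Split.leftUnit, Split.rightUnit,
      tensorObj, unit]
    exact Diagram.eq [B.neg, A.neg] (♯0 ⊠ ♯1)

theorem ofSplit_hexagon_forward (A B D : IntP C) :
    ofSplit (.assoc A B D) ≫ ofSplit (.braid A (tensorObj B D)) ≫ ofSplit (.assoc B D A) =
      homRight (ofSplit (.braid A B)) D ≫ ofSplit (.assoc B A D) ≫
        homLeft B (ofSplit (.braid A D)) := by
  simp only [homLeft_ofSplit, homRight_ofSplit, ofSplit_comp]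
  refine congrArg ofSplit (Split.ext ?_ ?_)
  · exact BraidedCategory.hexagon_forward _ _ _
  · dsimp only [Split.comp, Split.left, Split.right, Split.assoc, Split.braid, tensorObj]
    exact Diagram.eq [A.neg, D.neg, B.neg] ((♯0 ⊠ ♯1) ⊠ ♯2)

theorem ofSplit_hexagon_reverse (A B D : IntP C) :
    ofSplit (.assocInv A B D) ≫ ofSplit (.braid (tensorObj A B) D) ≫ ofSplit (.assocInv D A B) =
      homLeft A (ofSplit (.braid B D)) ≫ ofSplit (.assocInv A D B) ≫
        homRight (ofSplit (.braid A D)) B := by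
  simp only [homLeft_ofSplit, homRight_ofSplit, ofSplit_comp]
  refine congrArg ofSplit (Split.ext ?_ ?_)
  · exact BraidedCategory.hexagon_reverse _ _ _
  · dsimp only [Split.comp, Split.left, Split.right, Split.assocInv, Split.braid, tensorObj]
    exact Diagram.eq [B.neg, A.neg, D.neg] (♯0 ⊠ ♯1 ⊠ ♯2)

theorem ofSplit_symmetry (A B : IntP C) :
    ofSplit (.braid A B) ≫ ofSplit (.braid B A) = 𝟙 _ := by
  rw [ofSplit_comp, ← ofSplit_id]
  exact congrArg ofSplit
    (Split.ext (SymmetricCategory.symmetry _ _) (SymmetricCategory.symmetry _ _))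

theorem coevaluation_evaluation (A : IntP C) :
    ofHom (tensorHom (idHom A) (etaHom A)) ≫ ofSplit (.assocInv A A.dual A) ≫
      ofHom (tensorHom (epsHom A) (idHom A)) =
    ofSplit (.rightUnit A) ≫ ofSplit (.leftUnitInv A) := by
  rw [ofSplit_comp, ← Category.assoc, ofHom_comp_ofSplit]
  refine ofHom_comp_ofHom_eq_iff.2 ?_
  -- yanking `A.pos ⊗ A.neg` leaves the formal trace of `t` over `A.neg`, which is yanked in turn
  let t : ((A.pos ⊗ 𝟙_ C) ⊗ (A.neg ⊗ 𝟙_ C)) ⊗ A.neg ⟶ ((𝟙_ C ⊗ A.pos) ⊗ (𝟙_ C ⊗ A.neg)) ⊗ A.neg :=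
    ((ρ_ A.pos).hom ⊗ₘ (ρ_ A.neg).hom) ▷ A.neg ≫
      ((α_ A.pos A.neg A.neg).hom ≫ A.pos ◁ (β_ A.neg A.neg).hom ≫ (α_ A.pos A.neg A.neg).inv) ≫
      ((λ_ A.pos).inv ⊗ₘ (λ_ A.neg).inv) ▷ A.neg
  refine FormalTrace.Equiv.mem_tr (G := ⟨A.neg, t⟩) (.of_yanking (V := A.pos ⊗ A.neg) (Y := A.neg)
    (β_ A.neg (A.pos ⊗ A.neg) ≪≫ whiskerRightIso (β_ A.pos A.neg) A.neg ≪≫ α_ A.neg A.pos A.neg)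
    (whiskerRightIso (ρ_ A.pos ⊗ᵢ ρ_ A.neg) A.neg ≪≫ β_ (A.pos ⊗ A.neg) A.neg) ?_) ?_
  · dsimp only [postSplit]
    rw [tensorHom_id_left, rightOut, tensorHom_id_right]
    dsimp only [t, rightIn, tensorLeftIn, tensorLeftOut, tensorRightIn, tensorRightOut, etaHom,
      epsHom, tensorObj, dual, unit, Split.assocInv, Iso.trans_hom,
      Iso.trans_inv, Iso.symm_hom, Iso.symm_inv, whiskerLeftIso, whiskerRightIso, tensorIso]
    exact Diagram.eq [A.pos, A.neg, A.neg, A.pos, A.neg]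
      (((♯0 ⊠ .one) ⊠ (♯1 ⊠ .one)) ⊠ (♯2 ⊠ ♯3 ⊠ ♯4))
  · refine mem_tr_of_yanking _ _ ?_ rfl
    dsimp only [Split.hom, Split.comp, Split.rightUnit, Split.leftUnitInv, tensorObj, unit]
    exact Diagram.eq [A.pos, A.neg] ((♯0 ⊠ .one) ⊠ (♯1 ⊠ .one))

theorem evaluation_coevaluation (A : IntP C) :
    ofHom (tensorHom (etaHom A) (idHom A.dual)) ≫ ofSplit (.assoc A.dual A A.dual) ≫
      ofHom (tensorHom (idHom A.dual) (epsHom A)) =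
    ofSplit (.leftUnit A.dual) ≫ ofSplit (.rightUnitInv A.dual) := by
  rw [ofSplit_comp, ← Category.assoc, ofHom_comp_ofSplit]
  refine ofHom_comp_ofHom_eq_iff.2 ?_
  -- yanking `A.neg ⊗ A.pos` leaves the formal trace of `t` over `A.pos`, which is yanked in turn
  let t : ((𝟙_ C ⊗ A.neg) ⊗ (𝟙_ C ⊗ A.pos)) ⊗ A.pos ⟶ ((A.neg ⊗ 𝟙_ C) ⊗ (A.pos ⊗ 𝟙_ C)) ⊗ A.pos :=
    ((λ_ A.neg).hom ⊗ₘ (λ_ A.pos).hom) ▷ A.pos ≫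
      ((α_ A.neg A.pos A.pos).hom ≫ A.neg ◁ (β_ A.pos A.pos).hom ≫ (α_ A.neg A.pos A.pos).inv) ≫
      ((ρ_ A.neg).inv ⊗ₘ (ρ_ A.pos).inv) ▷ A.pos
  refine FormalTrace.Equiv.mem_tr (G := ⟨A.pos, t⟩) (.of_yanking (V := A.neg ⊗ A.pos) (Y := A.pos)
    (α_ A.pos A.neg A.pos)
    (whiskerRightIso (λ_ A.neg ⊗ᵢ λ_ A.pos) A.pos ≪≫ β_ (A.neg ⊗ A.pos) A.pos) ?_) ?_
  · dsimp only [postSplit]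
    rw [tensorHom_id_right, rightOut, tensorHom_id_left]
    dsimp only [t, rightIn, tensorLeftIn, tensorLeftOut, tensorRightIn, tensorRightOut, etaHom,
      epsHom, tensorObj, dual, unit, Split.assoc, Iso.trans_hom,
      Iso.trans_inv, whiskerRightIso, tensorIso]
    exact Diagram.eq [A.neg, A.pos, A.pos, A.neg, A.pos]
      (((.one ⊠ ♯0) ⊠ (.one ⊠ ♯1)) ⊠ ((♯2 ⊠ ♯3) ⊠ ♯4))
  · refine mem_tr_of_yanking _ _ ?_ rfl
    dsimp only [Split.hom, Split.comp, Split.leftUnit, Split.rightUnitInv, tensorObj, unit, dual]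
    exact Diagram.eq [A.neg, A.pos] ((.one ⊠ ♯0) ⊠ (.one ⊠ ♯1))

/-- The tensor product of the completion, with the structural isomorphisms of `Int^p(C)`. -/
scoped instance completionMonoidalStruct : MonoidalCategoryStruct (Completion C) where
  tensorObj X Y := of (tensorObj X.as Y.as)
  whiskerLeft X Y Z f := homLeft X.as (A := Y.as) (B := Z.as) f
  whiskerRight {Y Z} f X := homRight (A := Y.as) (B := Z.as) f X.as
  tensorUnit := of (unit C)
  associator X Y Z :=
    splitIso (A := tensorObj (tensorObj X.as Y.as) Z.as)
      (B := tensorObj X.as (tensorObj Y.as Z.as)) (α_ _ _ _) (α_ _ _ _)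
  leftUnitor X := splitIso (A := tensorObj (unit C) X.as) (B := X.as) (λ_ _) (ρ_ _).symm
  rightUnitor X := splitIso (A := tensorObj X.as (unit C)) (B := X.as) (ρ_ _) (λ_ _).symm

/-- The monoidal structure of the completion. -/
scoped instance completionMonoidal : MonoidalCategory (Completion C) where
  tensorHom_def _ _ := rfl
  id_tensorHom_id X Y :=
    (congrArg₂ (· ≫ ·) (homRight_id X.as Y.as) (homLeft_id X.as Y.as)).trans (Category.comp_id _)
  tensorHom_comp_tensorHom {X Y Z X' Y' Z'} f f' g g' :=
    tensorHom_interchange (A := X.as) (B := Y.as) (D := Z.as) (A' := X'.as) (B' := Y'.as)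
      (D' := Z'.as) f f' g g'
  whiskerLeft_id X Y := homLeft_id X.as Y.as
  id_whiskerRight X Y := homRight_id X.as Y.as
  associator_naturality {X Y Z X' Y' Z'} f g h :=
    tensorHom_assoc (A := X.as) (B := Y.as) (D := Z.as) (A' := X'.as) (B' := Y'.as)
      (D' := Z'.as) f g h
  leftUnitor_naturality {X Y} f := homLeft_unit (A := X.as) (B := Y.as) f
  rightUnitor_naturality {X Y} f := homRight_unit (A := X.as) (B := Y.as) f
  pentagon W X Y Z := ofSplit_pentagon W.as X.as Y.as Z.as
  triangle X Y := ofSplit_triangle X.as Y.as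

/-- The symmetric structure of the completion. -/
scoped instance completionSymmetric : SymmetricCategory (Completion C) where
  braiding X Y :=
    ⟨ofSplit (.braid X.as Y.as), ofSplit (.braid Y.as X.as), ofSplit_symmetry X.as Y.as,
      ofSplit_symmetry Y.as X.as⟩
  braiding_naturality_right X {Y Z} f := homLeft_braid X.as (B := Y.as) (B' := Z.as) f
  braiding_naturality_left {X Y} f Z := homRight_braid (A := X.as) (A' := Y.as) f Z.as
  hexagon_forward X Y Z := ofSplit_hexagon_forward X.as Y.as Z.as
  hexagon_reverse X Y Z := ofSplit_hexagon_reverse X.as Y.as Z.as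
  symmetry X Y := ofSplit_symmetry X.as Y.as

/-- The compact closed structure of the completion. -/
scoped instance completionLeftRigid : LeftRigidCategory (Completion C) where
  leftDual X :=
    { leftDual := of X.as.dual
      exact :=
        { coevaluation' := ofHom (etaHom X.as)
          evaluation' := ofHom (epsHom X.as)
          coevaluation_evaluation' := coevaluation_evaluation X.as
          evaluation_coevaluation' := evaluation_coevaluation X.as } }

theorem eq_eqToHom_comp {D : Type*} [Category D] {X Y : D} (f : X ⟶ Y) : f = eqToHom rfl ≫ f := by
  simp

theorem eq_eqToHom_comp_comp {D : Type*} [Category D] {X Y : D} (f : X ⟶ Y) :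
    f = eqToHom rfl ≫ f ≫ eqToHom rfl := by
  simp

theorem isInducedStructure : IsInducedStructure C where
  tensorObj_eq _ _ := rfl
  unit_eq := rfl
  tensorHom_eq f g := (ofHom_comp_ofHom_eq_iff.2 (tensorHom_isComp_right_left f g)).trans
    (eq_eqToHom_comp_comp (ofHom (tensorHom f g)))
  associator_eq A B D := eq_eqToHom_comp_comp (ofHom (assocHom A B D))
  leftUnitor_eq A := eq_eqToHom_comp (ofHom (leftUnitHom A))
  rightUnitor_eq A := eq_eqToHom_comp (ofHom (rightUnitHom A))
  braiding_eq A B := eq_eqToHom_comp_comp (ofHom (braidHom A B))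
  dual_eq _ := rfl
  eta_eq A := eq_eqToHom_comp_comp (ofHom (etaHom A))
  eps_eq A := eq_eqToHom_comp_comp (ofHom (epsHom A))

/-! ### The embedding -/

namespace Split

/-- The split arrow of `N f`. -/
def embedMap {A B : C} (f : A ⟶ B) : Split ((embed C).obj A) ((embed C).obj B) := ⟨f, 𝟙 (𝟙_ C)⟩

/-- The split arrow of `embedMu`. -/
def embedMu (A B : C) :
    Split (tensorObj ((embed C).obj A) ((embed C).obj B)) ((embed C).obj (A ⊗ B)) :=
  ⟨𝟙 (A ⊗ B), (λ_ (𝟙_ C)).inv⟩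

/-- The inverse of `Split.embedMu`. -/
def embedMuInv (A B : C) :
    Split ((embed C).obj (A ⊗ B)) (tensorObj ((embed C).obj A) ((embed C).obj B)) :=
  ⟨𝟙 (A ⊗ B), (λ_ (𝟙_ C)).hom⟩

end Split

theorem ofHom_embed_map {A B : C} (f : A ⟶ B) : ofHom ((embed C).map f) = ofSplit (.embedMap f) :=
  congrArg (fun k => ofHom (Hom.mk k)) (tensorHom_id f (𝟙_ C)).symm

theorem ofHom_embedMu (A B : C) : ofHom (embedMu A B) = ofSplit (.embedMu A B) :=
  congrArg (fun k => ofHom (A := tensorObj ((embed C).obj A) ((embed C).obj B))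
    (B := (embed C).obj (A ⊗ B)) (Hom.mk k)) (id_tensorHom (A ⊗ B) (λ_ (𝟙_ C)).inv).symm

variable (C) in
/-- The composite `F : C → Int^p(C) → Path(Int^p(C))/∼`. -/
def embedding : C ⥤ Completion C where
  obj A := of ((embed C).obj A)
  map f := ofHom ((embed C).map f)
  map_id A := (ofHom_embed_map (𝟙 A)).trans (ofSplit_id ((embed C).obj A))
  map_comp f g := by
    rw [ofHom_embed_map, ofHom_embed_map, ofHom_embed_map, ofSplit_comp]
    exact congrArg ofSplit (Split.ext rfl (Category.comp_id _).symm)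

/-- The comparison isomorphism `m_{A,B} : F A ⊗ F B ≅ F (A ⊗ B)`. -/
def muIso (A B : C) :
    of (tensorObj ((embed C).obj A) ((embed C).obj B)) ≅ of ((embed C).obj (A ⊗ B)) where
  hom := ofHom (embedMu A B)
  inv := ofSplit (.embedMuInv A B)
  hom_inv_id := by
    rw [ofHom_embedMu, ofSplit_comp, ← ofSplit_id]
    exact congrArg ofSplit (Split.ext (Category.comp_id _) (Iso.hom_inv_id _))
  inv_hom_id := by
    rw [ofHom_embedMu, ofSplit_comp, ← ofSplit_id]
    exact congrArg ofSplit (Split.ext (Category.comp_id _) (Iso.inv_hom_id _))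

theorem embedMu_naturality_left {A B : C} (f : A ⟶ B) (X : C) :
    homRight (ofHom ((embed C).map f)) ((embed C).obj X) ≫ ofHom (embedMu B X) =
      ofHom (embedMu A X) ≫ ofHom ((embed C).map (f ▷ X)) := by
  simp only [ofHom_embed_map, ofHom_embedMu, homRight_ofSplit, ofSplit_comp]
  refine congrArg ofSplit (Split.ext ?_ ?_) <;>
    dsimp only [Split.comp, Split.right, Split.embedMap, Split.embedMu, embed, tensorObj] <;> simp

theorem embedMu_naturality_right (X : C) {A B : C} (f : A ⟶ B) :
    homLeft ((embed C).obj X) (ofHom ((embed C).map f)) ≫ ofHom (embedMu X B) =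
      ofHom (embedMu X A) ≫ ofHom ((embed C).map (X ◁ f)) := by
  simp only [ofHom_embed_map, ofHom_embedMu, homLeft_ofSplit, ofSplit_comp]
  refine congrArg ofSplit (Split.ext ?_ ?_) <;>
    dsimp only [Split.comp, Split.left, Split.embedMap, Split.embedMu, embed, tensorObj] <;> simp

theorem embedMu_associativity (A B D : C) :
    homRight (ofHom (embedMu A B)) ((embed C).obj D) ≫ ofHom (embedMu (A ⊗ B) D) ≫
        ofHom ((embed C).map (α_ A B D).hom) =
      ofSplit (.assoc ((embed C).obj A) ((embed C).obj B) ((embed C).obj D)) ≫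
        homLeft ((embed C).obj A) (ofHom (embedMu B D)) ≫ ofHom (embedMu A (B ⊗ D)) := by
  simp only [ofHom_embed_map, ofHom_embedMu, homLeft_ofSplit, homRight_ofSplit, ofSplit_comp]
  refine congrArg ofSplit (Split.ext ?_ ?_) <;>
    dsimp only [Split.comp, Split.left, Split.right, Split.assoc, Split.embedMap, Split.embedMu,
      embed, tensorObj]
  · exact Diagram.eq [A, B, D] ((♯0 ⊠ ♯1) ⊠ ♯2)
  · exact Diagram.eq ([] : List C) .one

theorem embedMu_left_unitality (A : C) :
    ofSplit (.leftUnit ((embed C).obj A)) =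
      ofHom (embedMu (𝟙_ C) A) ≫ ofHom ((embed C).map (λ_ A).hom) := by
  simp only [ofHom_embed_map, ofHom_embedMu, ofSplit_comp]
  refine congrArg ofSplit (Split.ext ?_ ?_) <;>
    dsimp only [Split.comp, Split.leftUnit, Split.embedMap, Split.embedMu, embed, tensorObj]
  · exact Diagram.eq [A] (.one ⊠ ♯0)
  · exact Diagram.eq ([] : List C) .one

theorem embedMu_right_unitality (A : C) :
    ofSplit (.rightUnit ((embed C).obj A)) =
      ofHom (embedMu A (𝟙_ C)) ≫ ofHom ((embed C).map (ρ_ A).hom) := by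
  simp only [ofHom_embed_map, ofHom_embedMu, ofSplit_comp]
  refine congrArg ofSplit (Split.ext ?_ ?_) <;>
    dsimp only [Split.comp, Split.rightUnit, Split.embedMap, Split.embedMu, embed, tensorObj]
  · exact Diagram.eq [A] (♯0 ⊠ .one)
  · exact Diagram.eq ([] : List C) .one

theorem embedMu_braided (A B : C) :
    ofHom (embedMu A B) ≫ ofHom ((embed C).map (β_ A B).hom) =
      ofSplit (.braid ((embed C).obj A) ((embed C).obj B)) ≫ ofHom (embedMu B A) := by
  simp only [ofHom_embed_map, ofHom_embedMu, ofSplit_comp]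
  refine congrArg ofSplit (Split.ext ?_ ?_) <;>
    dsimp only [Split.comp, Split.braid, Split.embedMap, Split.embedMu, embed, tensorObj]
  · exact Diagram.eq [A, B] (♯0 ⊠ ♯1)
  · exact Diagram.eq ([] : List C) .one

variable (C) in
/-- The strong monoidal structure of the embedding. -/
def embeddingCoreMonoidal : (embedding C).CoreMonoidal where
  εIso := Iso.refl (of (unit C))
  μIso := muIso
  μIso_hom_natural_left f X := embedMu_naturality_left f X
  μIso_hom_natural_right X f := embedMu_naturality_right X f
  associativity A B D := embedMu_associativity A B D
  left_unitality A := (embedMu_left_unitality A).trans <| (Category.id_comp _).symm.trans <|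
    congrArg (· ≫ _) (homRight_id (unit C) ((embed C).obj A)).symm
  right_unitality A := (embedMu_right_unitality A).trans <| (Category.id_comp _).symm.trans <|
    congrArg (· ≫ _) (homLeft_id ((embed C).obj A) (unit C)).symm

/-- The embedding is a strong symmetric monoidal functor. -/
scoped instance embeddingBraided : (embedding C).Braided where
  toMonoidal := (embeddingCoreMonoidal C).toMonoidal
  braided A B := embedMu_braided A B

theorem embedding_faithful : (embedding C).Faithful where
  map_injective {_ _} f g h :=
    (whiskerRight_iff f g).1 (congrArg Hom.hom (ofHom_injective h))

theorem isComposite : IsComposite isInducedStructure (embedding C) where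
  obj_eq _ := rfl
  map_eq f := eq_eqToHom_comp_comp (ofHom ((embed C).map f))
  unit_eq := rfl
  mu_eq A B := eq_eqToHom_comp_comp (ofHom (embedMu A B))

/-! ### The canonical trace of embedded morphisms -/

/-- The canonical trace of `s`, up to the application of the counit: see
`canonicalTrace_ofSplit`. -/
def traceIn {A B U : IntP C} (s : Split (tensorObj A U) (tensorObj B U)) :
    A ⟶ tensorObj B (tensorObj U U.dual) :=
  preSplit (.rightUnitInv A) (postSplit (tensorHom (idHom A) (etaHom U))
    (((Split.braid U.dual U).left A).comp ((Split.assocInv A U U.dual).comp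
      ((s.right U.dual).comp (.assoc B U U.dual)))))

/-- The application of the counit in a canonical trace. -/
def traceOut (B U : IntP C) : tensorObj B (tensorObj U U.dual) ⟶ B :=
  postSplit (tensorHom (idHom B) (epsHom U)) (.rightUnit B)

theorem canonicalTrace_ofSplit {A B U : IntP C} (s : Split (tensorObj A U) (tensorObj B U)) :
    canonicalTrace (A := of A) (B := of B) (of U) (ofSplit s) =
      ofHom (traceIn s) ≫ ofHom (traceOut B U) := by
  calc
    _ = ofSplit (.rightUnitInv A) ≫ ofHom (tensorHom (idHom A) (etaHom U)) ≫
          homLeft A (ofSplit (.braid U.dual U)) ≫ ofSplit (.assocInv A U U.dual) ≫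
          homRight (ofSplit s) U.dual ≫ ofSplit (.assoc B U U.dual) ≫
          ofHom (tensorHom (idHom B) (epsHom U)) ≫ ofSplit (.rightUnit B) := rfl
    _ = _ := by
      rw [traceIn, traceOut, ← ofSplit_comp_ofHom, ← ofHom_comp_ofSplit, ← ofHom_comp_ofSplit,
        ← ofSplit_comp, ← ofSplit_comp, ← ofSplit_comp, homLeft_ofSplit, homRight_ofSplit]
      simp only [Category.assoc]

/-- The split arrow `m_{B,U}⁻¹ ∘ N f ∘ m_{A,U}`, whose canonical trace is compared with the trace
of `f`. -/
def Split.conjEmbed {A B U : C} (f : A ⊗ U ⟶ B ⊗ U) :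
    Split (tensorObj ((embed C).obj A) ((embed C).obj U))
      (tensorObj ((embed C).obj B) ((embed C).obj U)) :=
  (Split.embedMu A U).comp ((Split.embedMap f).comp (.embedMuInv B U))

theorem ofSplit_conjEmbed {A B U : C} (f : A ⊗ U ⟶ B ⊗ U) :
    ofSplit (.conjEmbed f) =
      ofHom (embedMu A U) ≫ ofHom ((embed C).map f) ≫ ofSplit (.embedMuInv B U) := by
  rw [ofHom_embedMu, ofHom_embed_map, ofSplit_comp, ofSplit_comp, Split.conjEmbed]

theorem mem_tr_conj_iff {A A' B B' U : C} (a : A' ≅ A) (b : B ≅ B') {f : A ⊗ U ⟶ B ⊗ U}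
    {t : A ⟶ B} :
    a.hom ≫ t ≫ b.hom ∈ tr U (a.hom ▷ U ≫ f ≫ b.hom ▷ U) ↔ t ∈ tr U f := by
  refine ⟨fun h => ?_, fun h => mem_tr_comp h _ _⟩
  simpa [← comp_whiskerRight_assoc, ← comp_whiskerRight] using mem_tr_comp h a.inv b.inv

theorem tr_traceIn_traceOut {A B U : C} (f : A ⊗ U ⟶ B ⊗ U) :
    tr ((U ⊗ 𝟙_ C) ⊗ 𝟙_ C : C)
      (rightIn ((embed C).obj A) (tensorObj ((embed C).obj B)
          (tensorObj ((embed C).obj U) ((embed C).obj U).dual)) ((embed C).obj B) ≫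
        𝟙_ C ◁ (traceIn (.conjEmbed f)).hom ≫
        rightOut ((embed C).obj A) (traceOut ((embed C).obj B) ((embed C).obj U))) =
      tr U ((ρ_ A).hom ▷ U ≫ f ≫ (ρ_ B).inv ▷ U) := by
  refine FormalTrace.trace_eq_of_conj (F := ⟨(U ⊗ 𝟙_ C) ⊗ 𝟙_ C, _⟩) (G := ⟨U, _⟩)
    (ρ_ (U ⊗ 𝟙_ C) ≪≫ ρ_ U) ?_
  dsimp only [rightOut, traceIn, traceOut, preSplit, postSplit]
  rw [tensorHom_id_left, tensorHom_id_left]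
  dsimp only [rightIn, tensorLeftIn, tensorLeftOut, etaHom, epsHom, tensorObj, dual, unit, embed,
    Split.comp, Split.left, Split.right, Split.conjEmbed, Split.embedMu, Split.embedMuInv,
    Split.embedMap, Split.braid, Split.assoc, Split.assocInv, Split.rightUnit, Split.rightUnitInv,
    Iso.trans_hom]
  let w : List C := [A, U, B, U]
  have := Diagram.box w (♯0 ⊠ ♯1) (♯2 ⊠ ♯3) f
  exact Diagram.eq w ((♯0 ⊠ .one) ⊠ ((♯1 ⊠ .one) ⊠ .one))

theorem isComp_traceIn_traceOut_iff {A B U : C} (f : A ⊗ U ⟶ B ⊗ U) (g : A ⟶ B) :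
    IsComp (traceIn (.conjEmbed f)) (traceOut ((embed C).obj B) ((embed C).obj U))
      ((embed C).map g) ↔ g ∈ tr U f := by
  have h := mem_tr_conj_iff (ρ_ A) (ρ_ B).symm (f := f) (t := g)
  rwa [Iso.symm_hom, ← whiskerRight_id, ← tr_traceIn_traceOut] at h

variable (C) in
/-- The canonical trace of the completion. -/
def completionTrace : TotalTrace (Completion C) := canonicalTotalTrace

theorem mem_tr_iff_completionTrace {A B U : C} (f : A ⊗ U ⟶ B ⊗ U) (g : A ⟶ B) :
    g ∈ tr U f ↔ (completionTrace C).tr ((embedding C).obj U)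
      (Functor.LaxMonoidal.μ (embedding C) A U ≫ (embedding C).map f ≫
        Functor.OplaxMonoidal.δ (embedding C) B U) = (embedding C).map g := by
  rw [← isComp_traceIn_traceOut_iff, ← ofHom_comp_ofHom_eq_iff, ← canonicalTrace_ofSplit]
  exact iff_of_eq (congrArg (· = ofHom ((embed C).map g))
    (congrArg (canonicalTrace (A := of ((embed C).obj A)) (B := of ((embed C).obj B))
      (of ((embed C).obj U))) (ofSplit_conjEmbed f)))

end IntP

end

theorem mainTheorem1 (C : Type u) [Category.{v} C] [MonoidalCategory C] [SymmetricCategory C]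
    [PartialTrace C] :
    -- `Path(Int^p(C))/∼` is compact closed, with the structure induced from `Int^p(C)`,
    ∃ (_ : MonoidalCategory (IntP.Completion C)) (_ : SymmetricCategory (IntP.Completion C))
      (_ : LeftRigidCategory (IntP.Completion C)) (hD : IntP.IsInducedStructure C)
      -- its canonical trace is a total trace,
      (T : TotalTrace (IntP.Completion C))
      (_ : ∀ {A B : IntP.Completion C} (U : IntP.Completion C) (f : A ⊗ U ⟶ B ⊗ U),
        T.tr U f = canonicalTrace U f)
      -- and the composite `C → Int^p(C) → Path(Int^p(C))/∼` is a strong symmetric monoidal functor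
      (F : C ⥤ IntP.Completion C) (_ : F.Braided),
      IntP.IsComposite hD F ∧
      -- that is faithful, and preserves and reflects the trace.
      F.Faithful ∧
      ∀ {A B U : C} (f : A ⊗ U ⟶ B ⊗ U) (g : A ⟶ B),
        g ∈ PartialTrace.tr U f ↔
          T.tr (F.obj U) (Functor.LaxMonoidal.μ F A U ≫ F.map f ≫
            Functor.OplaxMonoidal.δ F B U) = F.map g :=
  ⟨IntP.completionMonoidal, IntP.completionSymmetric, IntP.completionLeftRigid,
    IntP.isInducedStructure, IntP.completionTrace C, fun _ _ => rfl,
    IntP.embedding C, IntP.embeddingBraided, IntP.isComposite, IntP.embedding_faithful,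
    IntP.mem_tr_iff_completionTrace⟩
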